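/- Let $n\ge 2$, let $N$ be a compact $(n-1)$-dimensional smooth manifold (with or without boundary), let $-\infty\le a<b\le+\infty$ and $M=(a,b)\times N$. Let $\mathring h$ be a positive smooth function on $(a,b)$ and $\hat G$ a smooth Riemannian metric on $N$, with volume measure $\mu_{\hat G}$. On $M$ consider the warped product metric $g_0=dr^2+\mathring G(r)$, $\mathring G(r)=\mathring h(r)^2\hat G$, and a smooth Riemannian metric $g=dr^2+G(r)$, where $G(r)$ is a family of Riemannian metrics on $N$. Let $H$ and $\mathring H$ be the mean curvatures of the level sets $N(r)=\{r\}\times N$ (the traces of their Weingarten maps with respect to $\partial_r$, $X\mapsto\nabla_X\partial_r$) for $g$ and $g_0$ respectively, and let $R_{rr}$ and $\mathring R_{rr}$ be the Ricci curvatures of $g$ and $g_0$ in the direction $(\partial_r,\partial_r)$. Put $$m(r,x)=\mathring h(r)^2(\mathring H-H)(r,x),\qquad \mathcal M(r)=\int_N m(r,x)\,d\mu_{\hat G}(x).$$ Assume that the (finite) limits $\mathcal M(a)=\lim_{r\to a}\mathcal M(r)$ and $\mathcal M(b)=\lim_{r\to b}\mathcal M(r)$ exist and that $\mathring h^2(R_{rr}-\mathring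 R_{rr})\in L^1(M,dr\,d\mu_{\hat G})$. If $\mathcal M(b)\le\mathcal M(a)$, then $$\int_M\mathring h^2(R_{rr}-\mathring R_{rr})\,dr\,d\mu_{\hat G}\le 0,$$ with equality if and only if $g$ is a warped product $g=dr^2+\mathring h^2\widetilde G$ for some fixed smooth Riemannian metric $\widetilde G$ on $N$. If moreover $g$ is asymptotic to $g_0$ at some $r_0\in[a,b]$, i.e. $\|G(r)-\mathring G(r)\|_{\mathring G(r)}\to 0$ uniformly on $N$ as $r\to r_0$, $r\in(a,b)$ (for $r_0\in(a,b)$ this includes $r=r_0$, so that it means $G(r_0)=\mathring G(r_0)$), then equality holds if and only if $g=g_0$. -/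

import Mathlib

open Set Filter Topology MeasureTheory Bundle
open scoped Manifold ContDiff ENNReal

noncomputable section

/-! ### Riemannian geometry in charts -/

section Charts

variable {E : Type*} [NormedAddCommGroup E] [NormedSpace ℝ E]
  {H : Type*} [TopologicalSpace H] (I : ModelWithCorners ℝ E H)
  (M : Type*) [TopologicalSpace M] [ChartedSpace H M] [IsManifold I ∞ M]
  {ι : Type*} [Fintype ι] [DecidableEq ι] (β : Module.Basis ι ℝ E)

/-- A smooth Riemannian metric on the manifold `M` (possibly with boundary). -/
abbrev SmoothMetric := ContMDiffRiemannianMetric I ∞ E (fun x : M => TangentSpace I x)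

variable {I M}

/-- The `i`-th coordinate vector field `∂_i` of the preferred chart at `p`, at the point with
coordinate `y`; coordinates in the model space `E` are taken with respect to the basis `β`. -/
def coordVector (p : M) (i : ι) (y : E) : TangentSpace I ((extChartAt I p).symm y) :=
  mfderivWithin 𝓘(ℝ, E) I (extChartAt I p).symm (range I) y (β i)

/-- The matrix `(g_{ij})` of the metric in the preferred chart at `p`. -/
def metricMatrix (g : SmoothMetric I M) (p : M) (y : E) : Matrix ι ι ℝ :=
  Matrix.of fun i j =>
    g.inner ((extChartAt I p).symm y) (coordVector β p i y) (coordVector β p j y)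

variable (I) in
/-- The partial derivative `∂_i f` of a function of the coordinates of the chart at `p`. -/
def coordPartial (p : M) (i : ι) (f : E → ℝ) (y : E) : ℝ :=
  fderivWithin ℝ f (extChartAt I p).target y (β i)

/-- The Christoffel symbol
`Γ^k_{ij} = (1/2) ∑_l g^{kl} (∂_i g_{jl} + ∂_j g_{il} - ∂_l g_{ij})`
of the Levi-Civita connection in the preferred chart at `p`. -/
def christoffel (g : SmoothMetric I M) (p : M) (k i j : ι) (y : E) : ℝ :=
  (1 / 2 : ℝ) * ∑ l, (metricMatrix β g p y)⁻¹ k l *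
    (coordPartial I β p i (fun z => metricMatrix β g p z j l) y
      + coordPartial I β p j (fun z => metricMatrix β g p z i l) y
      - coordPartial I β p l (fun z => metricMatrix β g p z i j) y)

/-- The component
`R_{ij} = ∑_k (∂_k Γ^k_{ij} - ∂_j Γ^k_{ik}) + ∑_{k,l} (Γ^k_{kl} Γ^l_{ij} - Γ^k_{jl} Γ^l_{ik})`
of the Ricci tensor in the preferred chart at `p`. -/
def ricciComponent (g : SmoothMetric I M) (p : M) (i j : ι) (y : E) : ℝ :=
  (∑ k, (coordPartial I β p k (christoffel β g p k i j) y
      - coordPartial I β p j (christoffel β g p k i k) y))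
    + ∑ k, ∑ l, (christoffel β g p k k l y * christoffel β g p l i j y
      - christoffel β g p k j l y * christoffel β g p l i k y)

/-- The components of a tangent vector at `p` in the preferred chart at `p` (in Mathlib, the
tangent space at `p` is identified with `E` through this chart). -/
def vectorComponent (p : M) (v : TangentSpace I p) (i : ι) : ℝ := β.repr (show E from v) i

/-- The Ricci curvature `Ric_p(v, w) = ∑_{i,j} R_{ij} v^i w^j` of `g`. -/
def ricci (g : SmoothMetric I M) (p : M) (v w : TangentSpace I p) : ℝ :=
  ∑ i, ∑ j, ricciComponent β g p i j (extChartAt I p p)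
    * vectorComponent β p v i * vectorComponent β p w j

/-- The component `Y^k` of a vector field `Y` in the preferred chart at `p`, as a function of
the coordinates. -/
def fieldComponent (p : M) (Y : ∀ q : M, TangentSpace I q) (k : ι) (y : E) : ℝ :=
  β.repr (show E from mfderiv I 𝓘(ℝ, E) (extChartAt I p) ((extChartAt I p).symm y)
    (Y ((extChartAt I p).symm y))) k

/-- The Levi-Civita covariant derivative `∇_v Y` at `p`, whose `k`-th component is
`∑_i v^i (∂_i Y^k + ∑_j Γ^k_{ij} Y^j)`. -/
def covDeriv (g : SmoothMetric I M) (Y : ∀ q : M, TangentSpace I q) (p : M)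
    (v : TangentSpace I p) : TangentSpace I p :=
  show E from ∑ k, (∑ i, vectorComponent β p v i *
    (coordPartial I β p i (fieldComponent β p Y k) (extChartAt I p p)
      + ∑ j, christoffel β g p k i j (extChartAt I p p)
          * fieldComponent β p Y j (extChartAt I p p))) • β k

end Charts

/-! ### The Riemannian volume measure of a compact manifold -/

section Volume

variable {d : ℕ} {H : Type*} [TopologicalSpace H]
  (I : ModelWithCorners ℝ (EuclideanSpace ℝ (Fin d)) H)
  (N : Type*) [TopologicalSpace N] [ChartedSpace H N] [IsManifold I ∞ N]

/-- The standard basis of `ℝ^d`. -/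
abbrev stdBasis (d : ℕ) : Module.Basis (Fin d) ℝ (EuclideanSpace ℝ (Fin d)) :=
  (EuclideanSpace.basisFun (Fin d) ℝ).toBasis

/-- A smooth partition of unity subordinate to the domains of the preferred charts. -/
def chartPartition [CompactSpace N] [T2Space N] : SmoothPartitionOfUnity N I N univ :=
  (SmoothPartitionOfUnity.exists_isSubordinate_chartAt_source I N).choose

theorem chartPartition_isSubordinate [CompactSpace N] [T2Space N] :
    (chartPartition I N).IsSubordinate (fun x => (chartAt H x).source) :=
  (SmoothPartitionOfUnity.exists_isSubordinate_chartAt_source I N).choose_spec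

variable {I N}

/-- The Riemannian volume `√(det g_{AB}) dx¹ ⋯ dx^d` on the domain of the preferred chart
at `x`, as a measure on `N`. -/
def chartVolume [MeasurableSpace N] (G : SmoothMetric I N) (x : N) : Measure N :=
  Measure.map (extChartAt I x).symm
    ((volume.restrict (extChartAt I x).target).withDensity
      (fun y => ENNReal.ofReal (Real.sqrt (metricMatrix (stdBasis d) G x y).det)))

/-- The Riemannian volume measure of a compact Riemannian manifold, glued from its expressions
in charts by a smooth partition of unity. -/
def riemannianVolume [CompactSpace N] [T2Space N] [MeasurableSpace N]
    (G : SmoothMetric I N) : Measure N :=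
  Measure.sum fun i : N =>
    (chartVolume G i).withDensity (fun x => ENNReal.ofReal (chartPartition I N i x))

end Volume

/-! ### Metrics `dr² + G(r)` on `(a, b) × N` -/

section Radial

/-- The open interval `(a, b)` of `ℝ`, with possibly infinite end points. -/
def radialInterval (a b : EReal) : TopologicalSpace.Opens ℝ where
  carrier := {r : ℝ | a < (r : EReal) ∧ (r : EReal) < b}
  is_open' := (isOpen_lt continuous_const continuous_coe_real_ereal).inter
    (isOpen_lt continuous_coe_real_ereal continuous_const)

/-- The filter "`r → r₀`, `r ∈ (a, b)`", where `r₀ ∈ [a, b]` may be infinite. -/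
def radialNhds (a b r₀ : EReal) : Filter (radialInterval a b) :=
  comap (fun r : radialInterval a b => ((r : ℝ) : EReal)) (𝓝 r₀)

variable {d : ℕ} {H : Type*} [TopologicalSpace H]
  {I : ModelWithCorners ℝ (EuclideanSpace ℝ (Fin d)) H}
  {N : Type*} [TopologicalSpace N] [ChartedSpace H N] [IsManifold I ∞ N]
  {a b : EReal}

variable (I N a b) in
/-- Riemannian metrics on the manifold `M = (a, b) × N`. -/
abbrev CylinderMetric := SmoothMetric (𝓘(ℝ, ℝ).prod I) (radialInterval a b × N)

/-- The basis of the model space `ℝ × ℝ^d` of `(a, b) × N` which yields the adapted coordinates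
`(r, x¹, …, x^d)`; the index of `r` is `Sum.inl ()`. -/
abbrev adaptedBasis (d : ℕ) :
    Module.Basis (Unit ⊕ Fin d) ℝ (ℝ × EuclideanSpace ℝ (Fin d)) :=
  (Module.Basis.singleton Unit ℝ).prod (stdBasis d)

/-- The radial vector field `∂_r`. -/
def radialField (p : radialInterval a b × N) : TangentSpace (𝓘(ℝ, ℝ).prod I) p :=
  show ℝ × EuclideanSpace ℝ (Fin d) from (1, 0)

/-- A tangent vector of `N` at `x`, as a vector tangent to the level set `N(r)` at `(r, x)`. -/
def liftTangent (p : radialInterval a b × N) (v : TangentSpace I p.2) :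
    TangentSpace (𝓘(ℝ, ℝ).prod I) p :=
  show ℝ × EuclideanSpace ℝ (Fin d) from (0, v)

/-- The metric `G(r)` induced by `g` on the level set `N(r) = {r} × N`, at `x`. -/
def sliceMetric (g : CylinderMetric I N a b) (p : radialInterval a b × N)
    (v w : TangentSpace I p.2) : ℝ :=
  g.inner p (liftTangent p v) (liftTangent p w)

/-- `g = dr² + G(r)`. -/
def IsRadialMetric (g : CylinderMetric I N a b) : Prop :=
  (∀ p, g.inner p (radialField p) (radialField p) = 1) ∧
    ∀ p v, g.inner p (radialField p) (liftTangent p v) = 0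

/-- `g = dr² + h(r)² G` for the fixed metric `G` on `N`. -/
def IsWarpedProduct (g : CylinderMetric I N a b) (h : ℝ → ℝ) (G : SmoothMetric I N) : Prop :=
  IsRadialMetric g ∧ ∀ p v w, sliceMetric g p v w = h p.1 ^ 2 * G.inner p.2 v w

/-- The Weingarten map `S(v) = ∇_v ∂_r` of the level set `N(r)` with respect to `∂_r`, which is
a unit normal when `g = dr² + G(r)`. -/
def weingarten (g : CylinderMetric I N a b) (p : radialInterval a b × N)
    (v : TangentSpace I p.2) : TangentSpace I p.2 :=
  (show ℝ × EuclideanSpace ℝ (Fin d) from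
    covDeriv (adaptedBasis d) g radialField p (liftTangent p v)).2

/-- The mean curvature of the level set `N(r)`: the trace of its Weingarten map. -/
def meanCurvature (g : CylinderMetric I N a b) (p : radialInterval a b × N) : ℝ :=
  ∑ A, vectorComponent (stdBasis d) p.2 (weingarten g p (show EuclideanSpace ℝ (Fin d) from stdBasis d A)) A

/-- The Ricci curvature `R_{rr}` in the direction `(∂_r, ∂_r)`. -/
def radialRicci (g : CylinderMetric I N a b) (p : radialInterval a b × N) : ℝ :=
  ricci (adaptedBasis d) g p (radialField p) (radialField p)

/-- The radial mass `m(r, x) = h² (H₀ - H)` of `g` relative to `g₀`. -/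
def radialMass (g g₀ : CylinderMetric I N a b) (h : ℝ → ℝ) (p : radialInterval a b × N) : ℝ :=
  h p.1 ^ 2 * (meanCurvature g₀ p - meanCurvature g p)

/-- The integrand `h² (R_{rr} - R⁰_{rr})`. -/
def ricciDefect (g g₀ : CylinderMetric I N a b) (h : ℝ → ℝ) (p : radialInterval a b × N) : ℝ :=
  h p.1 ^ 2 * (radialRicci g p - radialRicci g₀ p)

/-- The matrix of the metric `G(r)` on `T_x N`. -/
def sliceMatrix (g : CylinderMetric I N a b) (p : radialInterval a b × N) :
    Matrix (Fin d) (Fin d) ℝ :=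
  Matrix.of fun A B => sliceMetric g p (show EuclideanSpace ℝ (Fin d) from stdBasis d A)
    (show EuclideanSpace ℝ (Fin d) from stdBasis d B)

/-- The norm of the tensor `T = G(r) - G₀(r)` with respect to `G₀(r)`:
`‖T‖² = ∑ G₀^{AC} G₀^{BD} T_{AB} T_{CD}`. -/
def sliceDistance (g g₀ : CylinderMetric I N a b) (p : radialInterval a b × N) : ℝ :=
  Real.sqrt (∑ A, ∑ B, ∑ C, ∑ D, (sliceMatrix g₀ p)⁻¹ A C * (sliceMatrix g₀ p)⁻¹ B D
    * (sliceMatrix g p - sliceMatrix g₀ p) A B * (sliceMatrix g p - sliceMatrix g₀ p) C D)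

/-- `g` is asymptotic to `g₀` at `r₀ ∈ [a, b]`: `‖G - G₀‖_{G₀} → 0` as `r → r₀`, uniformly
on `N`. -/
def IsAsymptoticAt (g g₀ : CylinderMetric I N a b) (r₀ : EReal) : Prop :=
  ∀ ε > 0, ∀ᶠ r in radialNhds a b r₀, ∀ x : N, sliceDistance g g₀ (r, x) < ε

variable [CompactSpace N] [T2Space N] [MeasurableSpace N]

/-- The radial mass `𝓜(r) = ∫_N m(r, x) dμ_G(x)` of `g` relative to `g₀` on `N(r)`. -/
def totalRadialMass (g g₀ : CylinderMetric I N a b) (h : ℝ → ℝ) (G : SmoothMetric I N)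
    (r : radialInterval a b) : ℝ :=
  ∫ x, radialMass g g₀ h (r, x) ∂(riemannianVolume G)

variable (a b) in
/-- The measure `dr dμ_G` on `(a, b) × N`. -/
def cylinderMeasure (G : SmoothMetric I N) : Measure (radialInterval a b × N) :=
  (Measure.comap (Subtype.val : radialInterval a b → ℝ) volume).prod (riemannianVolume G)

end Radial

end

/-! For a radial metric, `∂_r` is a unit geodesic field and the level sets have Weingarten map `S =
(1/2) G⁻¹ ∂_r G`, whose trace `H` obeys the Riccati equation `∂_r H = -R_rr - tr S²`
(`hasDerivAt_trace_shapeMatrix`). For the warped product, `S₀ = k·1` with `k = h'/h`. The weight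
`h²` completes the square: differentiating it contributes `2k h² (H₀ - H)`, and `tr S² - tr S₀² + 2k
(H₀ - H) = tr (S - k)²`. Hence `∂_r m = h² (R_rr - R⁰_rr) + h² tr (S - k)²`
(`hasDerivAt_radialMass`).

Since `S - k` is self-adjoint for `G(r)`, the last term is nonnegative and vanishes only if `S = k`
(`trace_sq_inv_mul_nonneg`, `eq_zero_of_trace_sq_inv_mul`). Integrating over `[r, s] × N`
(`totalRadialMass_sub`) and letting `r → a`, `s → b` gives the inequality
(`integral_nonpos_of_increment`). In the equality case the continuous square term vanishes
everywhere, so `∂_r G = 2kG`, and `G / h²` does not depend on `r`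
(`sliceMetric_eq_of_shapeDeviation`). Conversely, `R_rr` of a warped product depends on `h` alone
(`radialRicci_eq_of_warped`).

For two warped products with the same `h`, the distance measured by `G₀(r)` is constant in `r`, so
being asymptotic at a single `r₀` forces them to coincide (`eq_of_isAsymptoticAt`). -/

noncomputable section

/-! ### Smoothness and positivity of the metric matrix in a chart. -/

section ChartMetric

variable {E : Type*} [NormedAddCommGroup E] [NormedSpace ℝ E]
  {H : Type*} [TopologicalSpace H] {I : ModelWithCorners ℝ E H}
  {M : Type*} [TopologicalSpace M] [ChartedSpace H M] [IsManifold I ∞ M]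
  {ι : Type*} (β : Module.Basis ι ℝ E)

/-- The field on `M` obtained by transporting `v ∈ E` through the chart at `p`. -/
def chartField (p : M) (v : E) (q : M) : TangentSpace I q :=
  (trivializationAt E (TangentSpace I) p).symmL ℝ q v

/-- Trades a derivative of the inverse chart for a section that is constant in the bundle
trivialization, so that smoothness of `metricMatrix` follows from smoothness of the metric as a
bundle section. -/
theorem coordVector_eq_chartField (p : M) (i : ι) {y : E} (hy : y ∈ (extChartAt I p).target) :
    coordVector (I := I) β p i y = chartField p (β i) ((extChartAt I p).symm y) := by
  have h : (extChartAt I p).symm y ∈ (chartAt H p).source := by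
    simpa using (extChartAt I p).map_target hy
  rw [chartField, TangentBundle.symmL_trivializationAt h, coordVector,
    (extChartAt I p).right_inv hy]
  rfl

theorem chartField_self (p : M) (v : E) : chartField (I := I) p v p = v := by
  rw [chartField, TangentBundle.symmL_trivializationAt_eq_core (mem_chart_source H p)]
  exact (tangentBundleCore I M).coordChange_self (achart H p) p (mem_chart_source H p) v

theorem contMDiffOn_chartField (p : M) (v : E) :
    ContMDiffOn I (I.prod 𝓘(ℝ, E)) ∞
      (fun q => TotalSpace.mk' E q (chartField (I := I) p v q)) (chartAt H p).source := by
  have := (trivializationAt E (TangentSpace I : M → Type _) p).contMDiffOn_section_baseSet_iff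
    (IB := I) (n := ∞) (s := fun q => chartField (I := I) p v q)
  refine this.2 (contMDiffOn_const (c := v) |>.congr fun q hq => ?_)
  have := (trivializationAt E (TangentSpace I : M → Type _) p).apply_mk_symm hq v
  have h := (trivializationAt E (TangentSpace I : M → Type _) p).symmL_apply (R := ℝ) hq v
  rw [← h] at this
  exact congrArg Prod.snd this

theorem chartField_injective (p : M) {q : M} (hq : q ∈ (chartAt H p).source) {v : E}
    (hv : chartField (I := I) p v q = 0) : v = 0 := by
  have h := (trivializationAt E (TangentSpace I : M → Type _) p).continuousLinearMapAt_symmL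
    (R := ℝ) hq v
  have h' : (trivializationAt E (TangentSpace I : M → Type _) p).symmL ℝ q v = 0 := hv
  rw [h', map_zero] at h
  exact h.symm

theorem chartField_sum_smul [Fintype ι] (p q : M) (c : ι → ℝ) :
    chartField (I := I) p (∑ i, c i • β i) q = ∑ i, c i • chartField (I := I) p (β i) q := by
  simp only [chartField, map_sum, map_smul]

theorem metricMatrix_eq_chartField (g : SmoothMetric I M) (p : M) {y : E}
    (hy : y ∈ (extChartAt I p).target) (i j : ι) :
    metricMatrix β g p y i j = g.inner ((extChartAt I p).symm y)
      (chartField p (β i) ((extChartAt I p).symm y))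
      (chartField p (β j) ((extChartAt I p).symm y)) := by
  simp only [metricMatrix, Matrix.of_apply, coordVector_eq_chartField β p _ hy]

theorem metricMatrix_extChartAt (g : SmoothMetric I M) (p : M) {q : M}
    (hq : q ∈ (chartAt H p).source) (i j : ι) :
    metricMatrix β g p (extChartAt I p q) i j
      = g.inner q (chartField p (β i) q) (chartField p (β j) q) := by
  have hq' : q ∈ (extChartAt I p).source := by rwa [extChartAt_source]
  rw [metricMatrix_eq_chartField β g p ((extChartAt I p).map_source hq'),
    (extChartAt I p).left_inv hq']

theorem contMDiffOn_inner_chartField (g : SmoothMetric I M) (p : M) (v w : E) :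
    ContMDiffOn I 𝓘(ℝ, ℝ) ∞
      (fun q => g.inner q (chartField p v q) (chartField p w q)) (chartAt H p).source := by
  have h := ContMDiffOn.clm_bundle_apply₂ (F₁ := E) (F₂ := E) (F₃ := ℝ) (E₃ := fun _ : M => ℝ)
    (b := fun q : M => q) (ψ := fun q => g.inner q) (n := ∞)
    g.contMDiff.contMDiffOn (contMDiffOn_chartField (I := I) p v) (contMDiffOn_chartField p w)
  intro q hq
  have := (Bundle.contMDiffWithinAt_totalSpace.1 (h q hq)).2
  simpa using this

theorem contDiffOn_metricMatrix (g : SmoothMetric I M) (p : M) (i j : ι) :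
    ContDiffOn ℝ ∞ (fun y => metricMatrix β g p y i j) (extChartAt I p).target := by
  rw [← contMDiffOn_iff_contDiffOn]
  refine ((contMDiffOn_inner_chartField g p (β i) (β j)).comp
    (contMDiffOn_extChartAt_symm (n := ∞) p) fun y hy => ?_).congr fun y hy => ?_
  · simpa using (extChartAt I p).map_target hy
  · exact metricMatrix_eq_chartField β g p hy i j

theorem posDef_metricMatrix [Fintype ι] (g : SmoothMetric I M) (p : M) {y : E}
    (hy : y ∈ (extChartAt I p).target) : (metricMatrix β g p y).PosDef := by
  have h : (extChartAt I p).symm y ∈ (chartAt H p).source := by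
    simpa using (extChartAt I p).map_target hy
  refine Matrix.PosDef.of_dotProduct_mulVec_pos ?_ fun c hc => ?_
  · ext i j
    simp only [Matrix.conjTranspose_apply, metricMatrix, Matrix.of_apply, star_trivial]
    exact g.symm _ _ _
  · have hv : ∑ i, c i • β i ≠ 0 := fun h0 => hc <| by
      have := β.repr_sum_self c
      rw [h0, map_zero] at this
      exact this.symm
    have := g.pos _ _ fun h0 => hv (chartField_injective (I := I) p h h0)
    rw [chartField_sum_smul] at this
    simp only [map_sum, map_smul, sum_apply, smul_eq_mul,
      smul_apply] at this
    simp only [dotProduct, Matrix.mulVec, metricMatrix_eq_chartField β g p hy,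
      Pi.star_apply, star_trivial]
    refine this.trans_eq ?_
    simp only [Finset.mul_sum]
    rw [Finset.sum_comm]
    refine Finset.sum_congr rfl fun i _ => Finset.sum_congr rfl fun j _ => ?_
    ring

end ChartMetric

/-! ### Charts and tangent vectors of the product `(a, b) × N`. -/

section CylinderChart

theorem hasFDerivWithinAt_prod_comp_symm {α β F F' : Type*}
    [NormedAddCommGroup F] [NormedSpace ℝ F] [NormedAddCommGroup F'] [NormedSpace ℝ F']
    {e₁ e₁' : PartialEquiv α F} {e₂ e₂' : PartialEquiv β F'} {L₁ : F →L[ℝ] F} {L₂ : F' →L[ℝ] F'}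
    {s : Set F} {t : Set F'} {q : α × β}
    (h₁ : HasFDerivWithinAt (e₁' ∘ e₁.symm) L₁ s (e₁ q.1))
    (h₂ : HasFDerivWithinAt (e₂' ∘ e₂.symm) L₂ t (e₂ q.2)) :
    HasFDerivWithinAt (e₁'.prod e₂' ∘ (e₁.prod e₂).symm) (L₁.prodMap L₂) (s ×ˢ t)
      (e₁.prod e₂ q) :=
  HasFDerivWithinAt.prodMap (s := s ×ˢ t) (p := (e₁ q.1, e₂ q.2))
    (h₁.mono (fst_image_prod_subset s t)) (h₂.mono (snd_image_prod_subset s t))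

variable {d : ℕ} {H : Type*} [TopologicalSpace H]
  {I : ModelWithCorners ℝ (EuclideanSpace ℝ (Fin d)) H}
  {N : Type*} [TopologicalSpace N] [ChartedSpace H N]
  {a b : EReal}

theorem extChartAt_cylinder (p : radialInterval a b × N) :
    extChartAt (𝓘(ℝ, ℝ).prod I) p = (extChartAt 𝓘(ℝ, ℝ) p.1).prod (extChartAt I p.2) :=
  extChartAt_prod p

theorem extChartAt_radialInterval_source (r : radialInterval a b) :
    (extChartAt 𝓘(ℝ, ℝ) r).source = univ := by
  simp only [extChartAt_source, TopologicalSpace.Opens.chartAt_eq,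
    OpenPartialHomeomorph.subtypeRestr_source]
  exact eq_univ_of_forall fun _ => trivial

theorem extChartAt_radialInterval_target (r : radialInterval a b) :
    (extChartAt 𝓘(ℝ, ℝ) r).target = (radialInterval a b : Set ℝ) := by
  rw [← PartialEquiv.image_source_eq_target, extChartAt_radialInterval_source, image_univ]
  exact Subtype.range_coe

theorem extChartAt_cylinder_target (p : radialInterval a b × N) :
    (extChartAt (𝓘(ℝ, ℝ).prod I) p).target
      = (radialInterval a b : Set ℝ) ×ˢ (extChartAt I p.2).target := by
  rw [extChartAt_cylinder, PartialEquiv.prod_target, extChartAt_radialInterval_target]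

variable [IsManifold I ∞ N]

/-- The transition maps are products, and derivatives within the range of the model are unique
there, also at boundary points. -/
theorem tangentCoordChange_cylinder (p q : radialInterval a b × N)
    (hq : q.2 ∈ (chartAt H p.2).source) (w : ℝ × EuclideanSpace ℝ (Fin d)) :
    tangentCoordChange (𝓘(ℝ, ℝ).prod I) p q q w
      = (w.1, tangentCoordChange I p.2 q.2 q.2 w.2) := by
  have hq1 : q.1 ∈ (extChartAt 𝓘(ℝ, ℝ) p.1).source := by
    rw [extChartAt_radialInterval_source]; trivial
  have hq2 : q.2 ∈ (extChartAt I p.2).source := by rwa [extChartAt_source]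
  have hqp : q ∈ (extChartAt (𝓘(ℝ, ℝ).prod I) p).source := by
    rw [extChartAt_cylinder]; exact ⟨hq1, hq2⟩
  have h1 := hasFDerivWithinAt_tangentCoordChange (I := 𝓘(ℝ, ℝ)) (x := p.1) (y := q.1) (z := q.1)
    ⟨hq1, mem_extChartAt_source _⟩
  have h2 := hasFDerivWithinAt_tangentCoordChange (I := I) (x := p.2) (y := q.2) (z := q.2)
    ⟨hq2, mem_extChartAt_source _⟩
  have h := hasFDerivWithinAt_tangentCoordChange (I := 𝓘(ℝ, ℝ).prod I) (x := p) (y := q) (z := q)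
    ⟨hqp, mem_extChartAt_source _⟩
  have hs : range (𝓘(ℝ, ℝ).prod I) = range 𝓘(ℝ, ℝ) ×ˢ range I := range_prodMap
  have h12 : HasFDerivWithinAt (extChartAt (𝓘(ℝ, ℝ).prod I) q ∘
      (extChartAt (𝓘(ℝ, ℝ).prod I) p).symm)
      ((tangentCoordChange 𝓘(ℝ, ℝ) p.1 q.1 q.1).prodMap (tangentCoordChange I p.2 q.2 q.2))
      (range (𝓘(ℝ, ℝ).prod I)) (extChartAt (𝓘(ℝ, ℝ).prod I) p q) := by
    rw [hs, extChartAt_cylinder, extChartAt_cylinder]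
    exact hasFDerivWithinAt_prod_comp_symm h1 h2
  have hu := (𝓘(ℝ, ℝ).prod I).uniqueDiffOn _ (extChartAt_target_subset_range p
      ((extChartAt (𝓘(ℝ, ℝ).prod I) p).map_source hqp))
  rw [hu.eq h h12]
  -- All preferred charts of the interval are the inclusion into `ℝ`, so the radial block is the
  -- identity.
  exact Prod.ext (tangentCoordChange_self (I := 𝓘(ℝ, ℝ)) (x := p.1) hq1) rfl

theorem chartField_eq_tangentCoordChange (x : N) {q : N} (hq : q ∈ (chartAt H x).source)
    (v : EuclideanSpace ℝ (Fin d)) :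
    chartField (I := I) x v q = tangentCoordChange I x q q v := by
  rw [chartField, TangentBundle.symmL_trivializationAt_eq_core hq]
  rfl

theorem chartField_cylinder (p q : radialInterval a b × N) (hq : q.2 ∈ (chartAt H p.2).source)
    (w : ℝ × EuclideanSpace ℝ (Fin d)) :
    (chartField (I := 𝓘(ℝ, ℝ).prod I) p w q : ℝ × EuclideanSpace ℝ (Fin d))
      = (w.1, chartField (I := I) p.2 w.2 q.2) := by
  have hqp : q ∈ (chartAt (ModelProd ℝ H) p).source := by
    rw [← extChartAt_source (𝓘(ℝ, ℝ).prod I), extChartAt_cylinder, PartialEquiv.prod_source,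
      extChartAt_radialInterval_source, extChartAt_source]
    exact ⟨trivial, hq⟩
  rw [chartField, TangentBundle.symmL_trivializationAt_eq_core hqp,
    chartField_eq_tangentCoordChange _ hq]
  exact tangentCoordChange_cylinder p q hq w

end CylinderChart

/-! ### Christoffel symbols, mean curvature and radial Ricci curvature of `dr² + G(r)`. -/

section RadialCurvature

variable {d : ℕ} {H : Type*} [TopologicalSpace H]
  {I : ModelWithCorners ℝ (EuclideanSpace ℝ (Fin d)) H}
  {N : Type*} [TopologicalSpace N] [ChartedSpace H N] [IsManifold I ∞ N]
  {a b : EReal}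

theorem adaptedBasis_inl : adaptedBasis d (Sum.inl ()) = (1, 0) := by
  simp [adaptedBasis]

theorem adaptedBasis_inr (A : Fin d) : adaptedBasis d (Sum.inr A) = (0, stdBasis d A) := by
  simp [adaptedBasis]

theorem snd_mem_source_of_mem_target {p : radialInterval a b × N}
    {y : ℝ × EuclideanSpace ℝ (Fin d)} (hy : y ∈ (extChartAt (𝓘(ℝ, ℝ).prod I) p).target) :
    ((extChartAt (𝓘(ℝ, ℝ).prod I) p).symm y).2 ∈ (chartAt H p.2).source := by
  have := (extChartAt (𝓘(ℝ, ℝ).prod I) p).map_target hy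
  rw [extChartAt_cylinder, PartialEquiv.prod_source] at this
  rw [← extChartAt_source I, extChartAt_cylinder]
  exact this.2

theorem chartField_one_zero (p q : radialInterval a b × N)
    (hq : q.2 ∈ (chartAt H p.2).source) :
    chartField (I := 𝓘(ℝ, ℝ).prod I) p ((1, 0) : ℝ × EuclideanSpace ℝ (Fin d)) q
      = radialField q := by
  refine (chartField_cylinder p q hq _).trans ?_
  exact Prod.ext rfl (map_zero _)

theorem chartField_zero_prod (p q : radialInterval a b × N)
    (hq : q.2 ∈ (chartAt H p.2).source) (v : EuclideanSpace ℝ (Fin d)) :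
    chartField (I := 𝓘(ℝ, ℝ).prod I) p ((0, v) : ℝ × EuclideanSpace ℝ (Fin d)) q
      = liftTangent q (chartField p.2 v q.2) :=
  chartField_cylinder p q hq _

/-- The matrix `(g_{AB})` of the level sets in the preferred chart at `p`. -/
def sliceBlock (g : CylinderMetric I N a b) (p : radialInterval a b × N)
    (y : ℝ × EuclideanSpace ℝ (Fin d)) : Matrix (Fin d) (Fin d) ℝ :=
  Matrix.of fun A B => metricMatrix (adaptedBasis d) g p y (Sum.inr A) (Sum.inr B)

/-- The matrix `(∂_r g_{AB})` in the preferred chart at `p`. -/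
def sliceBlockDeriv (g : CylinderMetric I N a b) (p : radialInterval a b × N)
    (y : ℝ × EuclideanSpace ℝ (Fin d)) : Matrix (Fin d) (Fin d) ℝ :=
  Matrix.of fun A B => coordPartial (𝓘(ℝ, ℝ).prod I) (adaptedBasis d) p (Sum.inl ())
    (fun z => sliceBlock g p z A B) y

/-- The matrix `(1/2) G⁻¹ ∂_r G` of the Weingarten map in the preferred chart at `p`. -/
def shapeMatrix (g : CylinderMetric I N a b) (p : radialInterval a b × N)
    (y : ℝ × EuclideanSpace ℝ (Fin d)) : Matrix (Fin d) (Fin d) ℝ :=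
  (1 / 2 : ℝ) • ((sliceBlock g p y)⁻¹ * sliceBlockDeriv g p y)

theorem metricMatrix_eq_fromBlocks {g : CylinderMetric I N a b} (hg : IsRadialMetric g)
    (p : radialInterval a b × N) {y : ℝ × EuclideanSpace ℝ (Fin d)}
    (hy : y ∈ (extChartAt (𝓘(ℝ, ℝ).prod I) p).target) :
    metricMatrix (adaptedBasis d) g p y = Matrix.fromBlocks 1 0 0 (sliceBlock g p y) := by
  have hq := snd_mem_source_of_mem_target hy
  have h0 (A : Fin d) : metricMatrix (adaptedBasis d) g p y (Sum.inl ()) (Sum.inr A) = 0 := by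
    rw [metricMatrix_eq_chartField _ g p hy, adaptedBasis_inl, adaptedBasis_inr,
      chartField_one_zero p _ hq, chartField_zero_prod p _ hq]
    exact hg.2 _ _
  ext (i | A) (j | B)
  · rw [metricMatrix_eq_chartField _ g p hy, adaptedBasis_inl, chartField_one_zero p _ hq]
    exact (hg.1 _).trans (by simp)
  · exact h0 B
  · exact (g.symm _ _ _).trans (h0 A)
  · rfl

theorem posDef_sliceBlock (g : CylinderMetric I N a b)
    (p : radialInterval a b × N) {y : ℝ × EuclideanSpace ℝ (Fin d)}
    (hy : y ∈ (extChartAt (𝓘(ℝ, ℝ).prod I) p).target) : (sliceBlock g p y).PosDef :=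
  (posDef_metricMatrix (adaptedBasis d) g p hy).submatrix Sum.inr_injective

theorem metricMatrix_inv_eq_fromBlocks {g : CylinderMetric I N a b} (hg : IsRadialMetric g)
    (p : radialInterval a b × N) {y : ℝ × EuclideanSpace ℝ (Fin d)}
    (hy : y ∈ (extChartAt (𝓘(ℝ, ℝ).prod I) p).target) :
    (metricMatrix (adaptedBasis d) g p y)⁻¹ = Matrix.fromBlocks 1 0 0 (sliceBlock g p y)⁻¹ := by
  refine Matrix.inv_eq_right_inv ?_
  have hu := (posDef_sliceBlock g p hy).det_pos.ne'
  rw [metricMatrix_eq_fromBlocks hg p hy, Matrix.fromBlocks_multiply]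
  simp [Matrix.mul_nonsing_inv _ (isUnit_iff_ne_zero.2 hu)]

theorem contDiffOn_sliceBlock (g : CylinderMetric I N a b) (p : radialInterval a b × N)
    (A B : Fin d) :
    ContDiffOn ℝ ∞ (fun y => sliceBlock g p y A B) (extChartAt (𝓘(ℝ, ℝ).prod I) p).target :=
  contDiffOn_metricMatrix (adaptedBasis d) g p (Sum.inr A) (Sum.inr B)

theorem contDiffOn_sliceBlockDeriv (g : CylinderMetric I N a b) (p : radialInterval a b × N)
    (A B : Fin d) :
    ContDiffOn ℝ ∞ (fun y => sliceBlockDeriv g p y A B)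
      (extChartAt (𝓘(ℝ, ℝ).prod I) p).target :=
  ((contDiffOn_sliceBlock g p A B).fderivWithin (uniqueDiffOn_extChartAt_target p)
    (by simp)).clm_apply contDiffOn_const

theorem contDiffOn_det {X ι : Type*} [NormedAddCommGroup X] [NormedSpace ℝ X] [Fintype ι]
    [DecidableEq ι] {s : Set X} {F : X → Matrix ι ι ℝ}
    (hF : ∀ i j, ContDiffOn ℝ ∞ (fun y => F y i j) s) : ContDiffOn ℝ ∞ (fun y => (F y).det) s := by
  simp only [Matrix.det_apply]
  exact ContDiffOn.sum fun σ _ => (contDiffOn_prod fun i _ => hF _ _).const_smul _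

theorem contDiffOn_matrix_inv {X ι : Type*} [NormedAddCommGroup X] [NormedSpace ℝ X] [Fintype ι]
    [DecidableEq ι] {s : Set X} {F : X → Matrix ι ι ℝ}
    (hF : ∀ i j, ContDiffOn ℝ ∞ (fun y => F y i j) s) (h0 : ∀ y ∈ s, (F y).det ≠ 0) (i j : ι) :
    ContDiffOn ℝ ∞ (fun y => (F y)⁻¹ i j) s := by
  simp only [Matrix.inv_def, Matrix.smul_apply, Ring.inverse_eq_inv', smul_eq_mul,
    Matrix.adjugate_apply]
  refine ((contDiffOn_det hF).inv h0).mul (contDiffOn_det fun k l => ?_)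
  by_cases hk : k = j
  · subst hk
    simpa using contDiffOn_const
  · simpa [Matrix.updateRow_apply, hk] using hF k l

theorem contDiffOn_shapeMatrix (g : CylinderMetric I N a b) (p : radialInterval a b × N)
    (A B : Fin d) :
    ContDiffOn ℝ ∞ (fun y => shapeMatrix g p y A B)
      (extChartAt (𝓘(ℝ, ℝ).prod I) p).target := by
  simp only [shapeMatrix, Matrix.smul_apply, Matrix.mul_apply]
  refine ContDiffOn.const_smul _ (ContDiffOn.sum fun C _ => ?_)
  exact (contDiffOn_matrix_inv (contDiffOn_sliceBlock g p)
    (fun y hy => (posDef_sliceBlock g p hy).det_pos.ne') A C).mul (contDiffOn_sliceBlockDeriv g p C B)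

theorem coordPartial_congr (p : radialInterval a b × N) (i : Unit ⊕ Fin d)
    {f f' : ℝ × EuclideanSpace ℝ (Fin d) → ℝ}
    (hf : ∀ y ∈ (extChartAt (𝓘(ℝ, ℝ).prod I) p).target, f y = f' y)
    {y : ℝ × EuclideanSpace ℝ (Fin d)} (hy : y ∈ (extChartAt (𝓘(ℝ, ℝ).prod I) p).target) :
    coordPartial (𝓘(ℝ, ℝ).prod I) (adaptedBasis d) p i f y
      = coordPartial (𝓘(ℝ, ℝ).prod I) (adaptedBasis d) p i f' y := by
  rw [coordPartial, coordPartial, fderivWithin_congr hf (hf y hy)]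

theorem coordPartial_eq_zero (p : radialInterval a b × N) (i : Unit ⊕ Fin d)
    {f : ℝ × EuclideanSpace ℝ (Fin d) → ℝ} {c : ℝ}
    (hf : ∀ y ∈ (extChartAt (𝓘(ℝ, ℝ).prod I) p).target, f y = c)
    {y : ℝ × EuclideanSpace ℝ (Fin d)} (hy : y ∈ (extChartAt (𝓘(ℝ, ℝ).prod I) p).target) :
    coordPartial (𝓘(ℝ, ℝ).prod I) (adaptedBasis d) p i f y = 0 := by
  rw [coordPartial_congr p i (f' := fun _ => c) hf hy, coordPartial]
  simp

theorem sliceBlockDeriv_symm (g : CylinderMetric I N a b) (p : radialInterval a b × N)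
    (y : ℝ × EuclideanSpace ℝ (Fin d)) (A B : Fin d) :
    sliceBlockDeriv g p y A B = sliceBlockDeriv g p y B A := by
  have : (fun z => sliceBlock g p z A B) = fun z => sliceBlock g p z B A :=
    funext fun z => g.symm _ _ _
  simp only [sliceBlockDeriv, Matrix.of_apply, this]

variable {g : CylinderMetric I N a b} (hg : IsRadialMetric g) (p : radialInterval a b × N)
  {y : ℝ × EuclideanSpace ℝ (Fin d)} (hy : y ∈ (extChartAt (𝓘(ℝ, ℝ).prod I) p).target)

include hg hy

theorem coordPartial_metricMatrix_inl (i j : Unit ⊕ Fin d) :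
    coordPartial (𝓘(ℝ, ℝ).prod I) (adaptedBasis d) p i
      (fun z => metricMatrix (adaptedBasis d) g p z (Sum.inl ()) j) y = 0 :=
  coordPartial_eq_zero p i (c := Matrix.fromBlocks 1 0 0 (0 : Matrix (Fin d) (Fin d) ℝ) (Sum.inl ()) j)
    (fun z hz => by rw [metricMatrix_eq_fromBlocks hg p hz]; cases j <;> rfl) hy

theorem coordPartial_metricMatrix_inl_right (i j : Unit ⊕ Fin d) :
    coordPartial (𝓘(ℝ, ℝ).prod I) (adaptedBasis d) p i
      (fun z => metricMatrix (adaptedBasis d) g p z j (Sum.inl ())) y = 0 :=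
  coordPartial_eq_zero p i (c := Matrix.fromBlocks 1 0 0 (0 : Matrix (Fin d) (Fin d) ℝ) j (Sum.inl ()))
    (fun z hz => by rw [metricMatrix_eq_fromBlocks hg p hz]; cases j <;> rfl) hy

/-- The `r`-lines are geodesics: every derivative that occurs is of an entry with an index `r`, and
these entries are constant. -/
theorem christoffel_inl_inl (k : Unit ⊕ Fin d) :
    christoffel (adaptedBasis d) g p k (Sum.inl ()) (Sum.inl ()) y = 0 := by
  simp only [christoffel, coordPartial_metricMatrix_inl hg p hy]
  simp

theorem christoffel_inl_inr (A : Fin d) :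
    christoffel (adaptedBasis d) g p (Sum.inl ()) (Sum.inl ()) (Sum.inr A) y = 0 := by
  simp only [christoffel, coordPartial_metricMatrix_inl hg p hy,
    coordPartial_metricMatrix_inl_right hg p hy, metricMatrix_inv_eq_fromBlocks hg p hy,
    Fintype.sum_sum_type]
  simp

/-- Of the three derivatives only `∂_r g_{AD}` survives, and the inverse metric is block diagonal.
The version with the lower indices exchanged is proved separately below, since covariant
differentiation of `∂_r` uses that order. -/
theorem christoffel_inr_inl_inr (C A : Fin d) :
    christoffel (adaptedBasis d) g p (Sum.inr C) (Sum.inl ()) (Sum.inr A) y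
      = shapeMatrix g p y C A := by
  simp only [christoffel, coordPartial_metricMatrix_inl hg p hy,
    coordPartial_metricMatrix_inl_right hg p hy, metricMatrix_inv_eq_fromBlocks hg p hy,
    Fintype.sum_sum_type, shapeMatrix, Matrix.smul_apply, Matrix.mul_apply]
  simp only [Matrix.fromBlocks_apply₂₁, Matrix.fromBlocks_apply₂₂, Matrix.zero_apply, zero_mul,
    Finset.sum_const_zero, zero_add, add_zero, sub_zero, smul_eq_mul,
    sliceBlockDeriv_symm g p y _ A]
  rfl

theorem christoffel_inr_inr_inl (C A : Fin d) :
    christoffel (adaptedBasis d) g p (Sum.inr C) (Sum.inr A) (Sum.inl ()) y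
      = shapeMatrix g p y C A := by
  simp only [christoffel, coordPartial_metricMatrix_inl hg p hy,
    coordPartial_metricMatrix_inl_right hg p hy, metricMatrix_inv_eq_fromBlocks hg p hy,
    Fintype.sum_sum_type, shapeMatrix, Matrix.smul_apply, Matrix.mul_apply]
  simp only [Matrix.fromBlocks_apply₂₁, Matrix.fromBlocks_apply₂₂, Matrix.zero_apply, zero_mul,
    Finset.sum_const_zero, zero_add, add_zero, sub_zero, smul_eq_mul,
    sliceBlockDeriv_symm g p y _ A]
  rfl

/-- As `Γ^k_{rr} = 0` and `Γ^r_{rA} = 0`, only `-∂_r Γ^A_{rA}` and `-Γ^A_{rB} Γ^B_{rA}` remain. The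
symbols are known on the whole chart target, which allows them to be differentiated. -/
theorem ricciComponent_inl_inl :
    ricciComponent (adaptedBasis d) g p (Sum.inl ()) (Sum.inl ()) y
      = -coordPartial (𝓘(ℝ, ℝ).prod I) (adaptedBasis d) p (Sum.inl ())
          (fun z => (shapeMatrix g p z).trace) y
        - (shapeMatrix g p y * shapeMatrix g p y).trace := by
  have h0 (k : Unit ⊕ Fin d) : coordPartial (𝓘(ℝ, ℝ).prod I) (adaptedBasis d) p k
      (christoffel (adaptedBasis d) g p k (Sum.inl ()) (Sum.inl ())) y = 0 :=
    coordPartial_eq_zero p k (fun z hz => christoffel_inl_inl hg p hz k) hy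
  have h1 (A : Fin d) : coordPartial (𝓘(ℝ, ℝ).prod I) (adaptedBasis d) p (Sum.inl ())
      (christoffel (adaptedBasis d) g p (Sum.inr A) (Sum.inl ()) (Sum.inr A)) y
      = coordPartial (𝓘(ℝ, ℝ).prod I) (adaptedBasis d) p (Sum.inl ())
        (fun z => shapeMatrix g p z A A) y :=
    coordPartial_congr p _ (fun z hz => christoffel_inr_inl_inr hg p hz A A) hy
  have h2 : coordPartial (𝓘(ℝ, ℝ).prod I) (adaptedBasis d) p (Sum.inl ())
      (fun z => (shapeMatrix g p z).trace) y
      = ∑ A, coordPartial (𝓘(ℝ, ℝ).prod I) (adaptedBasis d) p (Sum.inl ())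
        (fun z => shapeMatrix g p z A A) y := by
    simp only [coordPartial, Matrix.trace, Matrix.diag_apply]
    rw [fderivWithin_fun_sum (uniqueDiffOn_extChartAt_target p y hy) fun A _ =>
      (contDiffOn_shapeMatrix g p A A).differentiableOn (by simp) y hy]
    simp
  rw [ricciComponent, h2]
  simp only [Fintype.sum_sum_type, h0, h1, Finset.univ_unique, PUnit.default_eq_unit,
    Finset.sum_singleton, christoffel_inl_inl hg p hy, christoffel_inl_inr hg p hy,
    christoffel_inr_inl_inr hg p hy, Matrix.trace, Matrix.diag_apply, Matrix.mul_apply]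
  simp [Finset.sum_neg_distrib]
  ring

omit hg in
theorem fieldComponent_radialField (k : Unit ⊕ Fin d) :
    fieldComponent (I := 𝓘(ℝ, ℝ).prod I) (adaptedBasis d) p radialField k y
      = if k = Sum.inl () then 1 else 0 := by
  have hq := snd_mem_source_of_mem_target hy
  have hs : (extChartAt (𝓘(ℝ, ℝ).prod I) p).symm y ∈ (chartAt (ModelProd ℝ H) p).source := by
    simpa only [extChartAt_source] using (extChartAt (𝓘(ℝ, ℝ).prod I) p).map_target hy
  have h1 := (trivializationAt (ℝ × EuclideanSpace ℝ (Fin d))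
    (TangentSpace (𝓘(ℝ, ℝ).prod I) : radialInterval a b × N → Type _) p).continuousLinearMapAt_symmL
    (R := ℝ) hs (1, 0)
  have h2 := chartField_one_zero (I := I) p _ hq
  rw [chartField] at h2
  rw [h2, TangentBundle.continuousLinearMapAt_trivializationAt hs] at h1
  have h3 : fieldComponent (I := 𝓘(ℝ, ℝ).prod I) (adaptedBasis d) p radialField k y
      = (adaptedBasis d).repr ((1, 0) : ℝ × EuclideanSpace ℝ (Fin d)) k :=
    congrArg (fun v => (adaptedBasis d).repr v k) h1
  rw [h3, ← adaptedBasis_inl, Module.Basis.repr_self, Finsupp.single_apply]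
  simp only [eq_comm]

omit hy in
-- The components of `∂_r` are constant in an adapted chart, so its covariant derivative consists of
-- Christoffel symbols only.
theorem meanCurvature_eq_trace :
    meanCurvature g p = (shapeMatrix g p (extChartAt (𝓘(ℝ, ℝ).prod I) p p)).trace := by
  have hy := mem_extChartAt_target (I := 𝓘(ℝ, ℝ).prod I) p
  have hcov (v : TangentSpace I p.2) (A : Fin d) :
      vectorComponent (stdBasis d) p.2 (weingarten g p v) A
        = ∑ i, vectorComponent (adaptedBasis d) p (liftTangent p v) i *
          christoffel (adaptedBasis d) g p (Sum.inr A) i (Sum.inl ())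
            (extChartAt (𝓘(ℝ, ℝ).prod I) p p) := by
    have h1 (w : ℝ × EuclideanSpace ℝ (Fin d)) :
        (stdBasis d).repr w.2 A = (adaptedBasis d).repr w (Sum.inr A) := by
      simp [adaptedBasis]
    refine (h1 _).trans ?_
    simp only [covDeriv]
    rw [Module.Basis.repr_sum_self]
    refine Finset.sum_congr rfl fun i _ => ?_
    rw [coordPartial_eq_zero p i (fun z hz => fieldComponent_radialField p hz (Sum.inr A)) hy]
    simp only [fieldComponent_radialField p hy, mul_ite, mul_one, mul_zero,
      Finset.sum_ite_eq', Finset.mem_univ, if_true, zero_add]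
  have hlift (A : Fin d) (i : Unit ⊕ Fin d) :
      vectorComponent (I := 𝓘(ℝ, ℝ).prod I) (adaptedBasis d) p (liftTangent (I := I) p
        (show EuclideanSpace ℝ (Fin d) from stdBasis d A)) i = if i = Sum.inr A then 1 else 0 := by
    have : vectorComponent (I := 𝓘(ℝ, ℝ).prod I) (adaptedBasis d) p (liftTangent (I := I) p
        (show EuclideanSpace ℝ (Fin d) from stdBasis d A)) i
        = (adaptedBasis d).repr ((0, stdBasis d A) : ℝ × EuclideanSpace ℝ (Fin d)) i := rfl
    rw [this, ← adaptedBasis_inr, Module.Basis.repr_self, Finsupp.single_apply]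
    simp only [eq_comm]
  refine Finset.sum_congr rfl fun A _ => (hcov _ A).trans ?_
  rw [Finset.sum_congr rfl fun i _ => congrArg (· * _) (hlift A i)]
  simp only [ite_mul, one_mul, zero_mul, Finset.sum_ite_eq', Finset.mem_univ, if_true,
    christoffel_inr_inr_inl hg p hy, Matrix.diag_apply]

omit hg hy in
theorem radialRicci_eq :
    radialRicci g p = ricciComponent (adaptedBasis d) g p (Sum.inl ()) (Sum.inl ())
      (extChartAt (𝓘(ℝ, ℝ).prod I) p p) := by
  have h (i : Unit ⊕ Fin d) : vectorComponent (I := 𝓘(ℝ, ℝ).prod I) (adaptedBasis d) p (radialField p) i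
      = if i = Sum.inl () then 1 else 0 := by
    have : vectorComponent (I := 𝓘(ℝ, ℝ).prod I) (adaptedBasis d) p (radialField p) i
        = (adaptedBasis d).repr ((1, 0) : ℝ × EuclideanSpace ℝ (Fin d)) i := rfl
    rw [this, ← adaptedBasis_inl, Module.Basis.repr_self, Finsupp.single_apply]
    simp only [eq_comm]
  simp only [radialRicci, ricci, h, mul_ite, mul_one, mul_zero, Finset.sum_ite_eq',
    Finset.mem_univ, if_true]

end RadialCurvature

/-! ### Differentiation along the lines `(a, b) × {x}`. -/

section RadialLine

variable {d : ℕ} {H : Type*} [TopologicalSpace H]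
  {I : ModelWithCorners ℝ (EuclideanSpace ℝ (Fin d)) H}
  {N : Type*} [TopologicalSpace N] [ChartedSpace H N] [IsManifold I ∞ N]
  {a b : EReal}

theorem mem_cylinder_target (p : radialInterval a b × N) {s : ℝ} (hs : s ∈ radialInterval a b)
    {y : EuclideanSpace ℝ (Fin d)} (hy : y ∈ (extChartAt I p.2).target) :
    (s, y) ∈ (extChartAt (𝓘(ℝ, ℝ).prod I) p).target := by
  rw [extChartAt_cylinder_target]; exact ⟨hs, hy⟩

/-- Even when `N` has boundary, the chart target is a product with an open radial factor, so the
derivative within the target in direction `r` is an ordinary one. -/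
theorem hasDerivAt_of_contDiffOn_target (p : radialInterval a b × N)
    {f : ℝ × EuclideanSpace ℝ (Fin d) → ℝ}
    (hf : ContDiffOn ℝ ∞ f (extChartAt (𝓘(ℝ, ℝ).prod I) p).target)
    {s : ℝ} (hs : s ∈ radialInterval a b)
    {y : EuclideanSpace ℝ (Fin d)} (hy : y ∈ (extChartAt I p.2).target) :
    HasDerivAt (fun t => f (t, y))
      (coordPartial (𝓘(ℝ, ℝ).prod I) (adaptedBasis d) p (Sum.inl ()) f (s, y)) s := by
  have h1 := ((hf.differentiableOn (by simp)) _ (mem_cylinder_target p hs hy)).hasFDerivWithinAt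
  have h2 : HasDerivWithinAt (fun t : ℝ => (t, y)) ((1 : ℝ), (0 : EuclideanSpace ℝ (Fin d)))
      (radialInterval a b) s :=
    ((hasDerivAt_id s).prodMk (hasDerivAt_const s y)).hasDerivWithinAt
  have h3 := h1.comp_hasDerivWithinAt s h2 (fun t ht => mem_cylinder_target p ht hy)
  rw [coordPartial, adaptedBasis_inl]
  exact h3.hasDerivAt ((radialInterval a b).isOpen.mem_nhds hs)

/-- The Riccati equation `∂_r H = -R_{rr} - tr(S²)`. -/
theorem hasDerivAt_trace_shapeMatrix {g : CylinderMetric I N a b} (hg : IsRadialMetric g)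
    (r s : radialInterval a b) (x : N) :
    HasDerivAt (fun t => (shapeMatrix g (r, x) (t, extChartAt I x x)).trace)
      (-radialRicci g (s, x) - (shapeMatrix g (r, x) (s, extChartAt I x x)
        * shapeMatrix g (r, x) (s, extChartAt I x x)).trace) s := by
  have hx := mem_extChartAt_target (I := I) x
  have h := hasDerivAt_of_contDiffOn_target (r, x) (f := fun z => (shapeMatrix g (r, x) z).trace)
    (by
      simp only [Matrix.trace, Matrix.diag_apply]
      exact ContDiffOn.sum fun A _ => contDiffOn_shapeMatrix g (r, x) A A) s.2 hx
  have h2 := radialRicci_eq (g := g) (s, x)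
  rw [ricciComponent_inl_inl hg (s, x) (mem_extChartAt_target (s, x))] at h2
  refine h.congr_deriv ?_
  rw [h2]
  simp only [neg_sub, sub_neg_eq_add]
  -- The preferred charts at `(r, x)` and `(s, x)` agree by definition, which identifies the two
  -- coordinate expressions.
  exact (add_sub_cancel_left _ _).symm

/-- One chart serves the whole line over `x`, which makes `H` a differentiable function of one real
variable there. -/
theorem meanCurvature_eq {g : CylinderMetric I N a b} (hg : IsRadialMetric g)
    (r s : radialInterval a b) (x : N) :
    meanCurvature g (s, x) = (shapeMatrix g (r, x) (s, extChartAt I x x)).trace :=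
  meanCurvature_eq_trace hg (s, x)

theorem sliceBlock_center (g : CylinderMetric I N a b) (r s : radialInterval a b) (x : N) :
    sliceBlock g (r, x) (s, extChartAt I x x) = sliceMatrix g (s, x) := by
  ext A B
  refine (metricMatrix_extChartAt (adaptedBasis d) g (s, x) (mem_chart_source _ (s, x)) _ _).trans ?_
  rw [chartField_self, chartField_self, adaptedBasis_inr, adaptedBasis_inr]
  rfl

end RadialLine

/-! ### Positivity of `tr ((G⁻¹ B)²)` for symmetric `B`. -/

section TraceSquare

variable {ι : Type*} [Fintype ι] [DecidableEq ι]

open scoped MatrixOrder Matrix.Norms.L2Operator in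
theorem exists_isUnit_conjTranspose_mul_self {G : Matrix ι ι ℝ} (hG : G.PosDef) :
    ∃ C : Matrix ι ι ℝ, IsUnit C ∧ G = C.conjTranspose * C :=
  CStarAlgebra.isStrictlyPositive_iff_eq_star_mul_self.1
    (Matrix.isStrictlyPositive_iff_posDef.2 hG)

/-- Write `G⁻¹ = Cᵀ C`. Then `G⁻¹ B` is similar to the symmetric matrix `C B Cᵀ`, and the trace of
its square is a sum of squares of entries. -/
theorem trace_sq_inv_mul_eq {G B : Matrix ι ι ℝ} (hG : G.PosDef) (hB : B.IsSymm) :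
    ∃ C : Matrix ι ι ℝ, IsUnit C ∧
      (G⁻¹ * B * (G⁻¹ * B)).trace
        = ((C * B * C.transpose) * (C * B * C.transpose).conjTranspose).trace := by
  obtain ⟨C, hC, hGC⟩ := exists_isUnit_conjTranspose_mul_self hG.inv
  refine ⟨C, hC, ?_⟩
  have hX : (C * B * C.transpose).conjTranspose = C * B * C.transpose := by
    simp [Matrix.conjTranspose_eq_transpose_of_trivial, Matrix.transpose_mul, hB.eq,
      Matrix.mul_assoc]
  rw [hX, hGC, Matrix.conjTranspose_eq_transpose_of_trivial]
  calc (C.transpose * C * B * (C.transpose * C * B)).trace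
      = (C.transpose * (C * B * C.transpose * C * B)).trace := by simp only [Matrix.mul_assoc]
    _ = (C * B * C.transpose * C * B * C.transpose).trace := Matrix.trace_mul_comm _ _
    _ = _ := by simp only [Matrix.mul_assoc]

theorem trace_sq_inv_mul_nonneg {G B : Matrix ι ι ℝ} (hG : G.PosDef) (hB : B.IsSymm) :
    0 ≤ (G⁻¹ * B * (G⁻¹ * B)).trace := by
  obtain ⟨C, -, h⟩ := trace_sq_inv_mul_eq hG hB
  rw [h]
  exact (Matrix.posSemidef_self_mul_conjTranspose _).trace_nonneg

theorem eq_zero_of_trace_sq_inv_mul {G B : Matrix ι ι ℝ} (hG : G.PosDef) (hB : B.IsSymm)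
    (h0 : (G⁻¹ * B * (G⁻¹ * B)).trace = 0) : B = 0 := by
  obtain ⟨C, hC, h⟩ := trace_sq_inv_mul_eq hG hB
  rw [h, Matrix.trace_mul_conjTranspose_self_eq_zero_iff] at h0
  have hC' : IsUnit C.transpose := (Matrix.isUnit_transpose _).2 hC
  rwa [hC'.mul_left_eq_zero, hC.mul_right_eq_zero] at h0

end TraceSquare

/-! ### The Weingarten map: chart independence, continuity, deviation from a multiple of the
identity. -/

section Shape

variable {d : ℕ} {H : Type*} [TopologicalSpace H]
  {I : ModelWithCorners ℝ (EuclideanSpace ℝ (Fin d)) H}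
  {N : Type*} [TopologicalSpace N] [ChartedSpace H N] [IsManifold I ∞ N]
  {a b : EReal}

/-- The matrix of the Weingarten map of a radial metric. -/
def shapeOperator (g : CylinderMetric I N a b) (p : radialInterval a b × N) :
    Matrix (Fin d) (Fin d) ℝ :=
  shapeMatrix g p (extChartAt (𝓘(ℝ, ℝ).prod I) p p)

/-- The radial derivative of the matrix of the metric `G(r)`. -/
def sliceMatrixDeriv (g : CylinderMetric I N a b) (p : radialInterval a b × N) :
    Matrix (Fin d) (Fin d) ℝ :=
  sliceBlockDeriv g p (extChartAt (𝓘(ℝ, ℝ).prod I) p p)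

theorem shapeOperator_eq (g : CylinderMetric I N a b) (p : radialInterval a b × N) :
    shapeOperator g p = (1 / 2 : ℝ) • ((sliceMatrix g p)⁻¹ * sliceMatrixDeriv g p) := by
  rw [shapeOperator, shapeMatrix, ← sliceBlock_center g p.1 p.1 p.2]
  rfl

theorem posDef_sliceMatrix (g : CylinderMetric I N a b) (p : radialInterval a b × N) :
    (sliceMatrix g p).PosDef := by
  rw [← sliceBlock_center g p.1 p.1 p.2]
  exact posDef_sliceBlock g p (mem_extChartAt_target p)

theorem hasDerivAt_sliceBlock (g : CylinderMetric I N a b) (p : radialInterval a b × N)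
    (s : radialInterval a b) {y : EuclideanSpace ℝ (Fin d)} (hy : y ∈ (extChartAt I p.2).target)
    (A B : Fin d) :
    HasDerivAt (fun t => sliceBlock g p (t, y) A B) (sliceBlockDeriv g p (s, y) A B) s :=
  hasDerivAt_of_contDiffOn_target p (contDiffOn_sliceBlock g p A B) s.2 hy

theorem hasDerivAt_sliceBlock_center (g : CylinderMetric I N a b) (r s : radialInterval a b)
    (x : N) (A B : Fin d) :
    HasDerivAt (fun t => sliceBlock g (r, x) (t, extChartAt I x x) A B)
      (sliceMatrixDeriv g (s, x) A B) s :=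
  hasDerivAt_sliceBlock g (r, x) s (mem_extChartAt_target x) A B

theorem sliceMetric_eq_sum (g : CylinderMetric I N a b) (p : radialInterval a b × N)
    (v w : EuclideanSpace ℝ (Fin d)) :
    sliceMetric g p v w = ∑ A, ∑ B, v A * w B * sliceMatrix g p A B := by
  have hv (v : EuclideanSpace ℝ (Fin d)) : v = ∑ A, v A • stdBasis d A := by
    conv_lhs => rw [← (stdBasis d).sum_repr v]
    simp
  have hl (v : EuclideanSpace ℝ (Fin d)) :
      (liftTangent (I := I) p v : ℝ × EuclideanSpace ℝ (Fin d))
        = ∑ A, v A • ((0, stdBasis d A) : ℝ × EuclideanSpace ℝ (Fin d)) := by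
    refine Prod.ext ?_ ?_
    · simp [liftTangent, Prod.fst_sum]
    · simpa [liftTangent, Prod.snd_sum] using hv v
  have key (L : (ℝ × EuclideanSpace ℝ (Fin d)) →L[ℝ] (ℝ × EuclideanSpace ℝ (Fin d)) →L[ℝ] ℝ)
      (V W : ℝ × EuclideanSpace ℝ (Fin d)) (E : Fin d → ℝ × EuclideanSpace ℝ (Fin d))
      (hV : V = ∑ A, v A • E A) (hW : W = ∑ A, w A • E A) :
      L V W = ∑ A, ∑ B, v A * w B * L (E A) (E B) := by
    rw [hV, hW]
    simp only [map_sum, map_smul, sum_apply, smul_apply, smul_eq_mul, Finset.mul_sum, mul_assoc]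
    rw [Finset.sum_comm]
    refine Finset.sum_congr rfl fun A _ => Finset.sum_congr rfl fun B _ => by ring
  exact key (g.inner p) _ _ (fun A => (0, stdBasis d A)) (hl v) (hl w)

/-- The change of coordinates takes place in `N` alone, so one matrix `P` works for all `s`; the
relation can therefore be differentiated in `r`. -/
theorem sliceBlock_change (g : CylinderMetric I N a b) (p : radialInterval a b × N)
    {x : N} (hx : x ∈ (chartAt H p.2).source) :
    ∃ P : Matrix (Fin d) (Fin d) ℝ, ∀ s : radialInterval a b,
      sliceBlock g p (s, extChartAt I p.2 x) = P.transpose * sliceMatrix g (s, x) * P := by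
  refine ⟨Matrix.of fun C A =>
    (show EuclideanSpace ℝ (Fin d) from chartField (I := I) p.2 (stdBasis d A) x) C, fun s => ?_⟩
  have hs : (s, x) ∈ (chartAt (ModelProd ℝ H) p).source := by
    rw [← extChartAt_source (𝓘(ℝ, ℝ).prod I), extChartAt_cylinder, PartialEquiv.prod_source,
      extChartAt_radialInterval_source, extChartAt_source]
    exact ⟨trivial, hx⟩
  ext A B
  refine (metricMatrix_extChartAt (adaptedBasis d) g p hs (Sum.inr A) (Sum.inr B)).trans ?_
  rw [adaptedBasis_inr, adaptedBasis_inr, chartField_zero_prod p (s, x) hx,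
    chartField_zero_prod p (s, x) hx]
  refine (sliceMetric_eq_sum g (s, x) _ _).trans ?_
  simp only [Matrix.mul_apply, Matrix.transpose_apply, Matrix.of_apply, Finset.sum_mul]
  rw [Finset.sum_comm]
  refine Finset.sum_congr rfl fun C _ => Finset.sum_congr rfl fun D _ => by ring

/-- `G` and `∂_r G` change by the same congruence, so `G⁻¹ ∂_r G` changes by conjugation, and traces
of its polynomials do not depend on the chart. -/
theorem shapeMatrix_change (g : CylinderMetric I N a b) (p : radialInterval a b × N)
    {x : N} (hx : x ∈ (chartAt H p.2).source) (s : radialInterval a b) :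
    ∃ P : Matrix (Fin d) (Fin d) ℝ, IsUnit P ∧
      shapeMatrix g p (s, extChartAt I p.2 x) = P⁻¹ * shapeOperator g (s, x) * P := by
  obtain ⟨P, hP⟩ := sliceBlock_change g p hx
  have hy : extChartAt I p.2 x ∈ (extChartAt I p.2).target :=
    (extChartAt I p.2).map_source (by rwa [extChartAt_source])
  have hdet : IsUnit P := by
    rw [Matrix.isUnit_iff_isUnit_det, isUnit_iff_ne_zero]
    -- A singular `P` would make the positive definite matrix `Pᵀ G P` singular.
    intro h0
    have h := (posDef_sliceBlock g p (mem_cylinder_target p s.2 hy)).det_pos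
    rw [hP s, Matrix.det_mul, h0, mul_zero] at h
    exact h.false
  have hD : sliceBlockDeriv g p (s, extChartAt I p.2 x)
      = P.transpose * sliceMatrixDeriv g (s, x) * P := by
    ext A B
    refine (hasDerivAt_sliceBlock g p s hy A B).unique ?_
    have h1 : HasDerivAt (fun t => (P.transpose * sliceBlock g (s, x) (t, extChartAt I x x) * P) A B)
        ((P.transpose * sliceMatrixDeriv g (s, x) * P) A B) s := by
      simp only [Matrix.mul_apply]
      refine HasDerivAt.fun_sum fun C _ => HasDerivAt.mul_const (HasDerivAt.fun_sum fun D _ => ?_) _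
      exact (hasDerivAt_sliceBlock_center g s s x D C).const_mul _
    refine h1.congr_of_eventuallyEq ?_
    filter_upwards [(radialInterval a b).isOpen.mem_nhds s.2] with t ht
    rw [hP ⟨t, ht⟩, ← sliceBlock_center g s ⟨t, ht⟩ x]
  refine ⟨P, hdet, ?_⟩
  have hPt : IsUnit P.transpose := (Matrix.isUnit_transpose _).2 hdet
  rw [shapeMatrix, hP s, hD, shapeOperator_eq, Matrix.mul_inv_rev, Matrix.mul_inv_rev]
  have : P.transpose⁻¹ * P.transpose = 1 :=
    Matrix.nonsing_inv_mul _ ((Matrix.isUnit_iff_isUnit_det _).1 hPt)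
  rw [Matrix.mul_smul, Matrix.smul_mul]
  congr 1
  calc P⁻¹ * ((sliceMatrix g (s, x))⁻¹ * P.transpose⁻¹)
        * (P.transpose * sliceMatrixDeriv g (s, x) * P)
      = P⁻¹ * (sliceMatrix g (s, x))⁻¹ * (P.transpose⁻¹ * P.transpose)
        * sliceMatrixDeriv g (s, x) * P := by simp only [Matrix.mul_assoc]
    _ = _ := by rw [this, Matrix.mul_one]; simp only [Matrix.mul_assoc]

/-- `tr((S - k)²)`, the squared norm of the deviation of the Weingarten map from `k`. -/
def shapeDeviation (g : CylinderMetric I N a b) (k : ℝ → ℝ) (p : radialInterval a b × N) : ℝ :=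
  ((shapeOperator g p - k p.1 • 1) * (shapeOperator g p - k p.1 • 1)).trace

theorem trace_conj {P : Matrix (Fin d) (Fin d) ℝ} (hP : IsUnit P) (S : Matrix (Fin d) (Fin d) ℝ) :
    (P⁻¹ * S * P).trace = S.trace := by
  rw [Matrix.trace_mul_cycle, Matrix.mul_nonsing_inv _ ((Matrix.isUnit_iff_isUnit_det _).1 hP),
    Matrix.one_mul]

/-- The pointwise quantities are computed at each point in that point's own preferred chart, which
need not vary continuously. Continuity requires comparing them with an expression in one fixed chart
nearby. -/
theorem continuous_of_chart {f : radialInterval a b × N → ℝ}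
    (F : radialInterval a b × N → ℝ × EuclideanSpace ℝ (Fin d) → ℝ)
    (hF : ∀ p, ContinuousOn (F p) (extChartAt (𝓘(ℝ, ℝ).prod I) p).target)
    (hf : ∀ p : radialInterval a b × N, ∀ s : radialInterval a b, ∀ x ∈ (chartAt H p.2).source,
      f (s, x) = F p (s, extChartAt I p.2 x)) : Continuous f := by
  rw [continuous_iff_continuousAt]
  intro p
  have h1 : ContinuousOn (fun q => F p (extChartAt (𝓘(ℝ, ℝ).prod I) p q))
      (extChartAt (𝓘(ℝ, ℝ).prod I) p).source :=
    (hF p).comp (continuousOn_extChartAt p) (extChartAt (𝓘(ℝ, ℝ).prod I) p).mapsTo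
  refine (h1.congr fun q hq => ?_).continuousAt (extChartAt_source_mem_nhds p)
  rw [extChartAt_cylinder, PartialEquiv.prod_source, extChartAt_source I] at hq
  exact hf p q.1 q.2 hq.2

theorem continuous_meanCurvature {g : CylinderMetric I N a b} (hg : IsRadialMetric g) :
    Continuous (meanCurvature g) := by
  refine continuous_of_chart (I := I) (fun p y => (shapeMatrix g p y).trace) (fun p => ?_)
    fun p s x hx => ?_
  · simp only [Matrix.trace, Matrix.diag_apply]
    exact continuousOn_finsetSum _ fun A _ => (contDiffOn_shapeMatrix g p A A).continuousOn
  · obtain ⟨P, hP, h⟩ := shapeMatrix_change g p hx s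
    rw [h, trace_conj hP]
    exact meanCurvature_eq_trace hg _

theorem continuous_shapeDeviation (g : CylinderMetric I N a b) {k : ℝ → ℝ}
    (hk : ContinuousOn k (radialInterval a b)) : Continuous (shapeDeviation g k) := by
  refine continuous_of_chart (I := I)
    (fun p y => ((shapeMatrix g p y - k y.1 • 1) * (shapeMatrix g p y - k y.1 • 1)).trace)
    (fun p => ?_) fun p s x hx => ?_
  · have hk' : ContinuousOn (fun y : ℝ × EuclideanSpace ℝ (Fin d) => k y.1)
        (extChartAt (𝓘(ℝ, ℝ).prod I) p).target := by
      refine hk.comp continuousOn_fst fun y hy => ?_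
      rw [extChartAt_cylinder_target] at hy
      exact hy.1
    have h (A B : Fin d) : ContinuousOn (fun y => (shapeMatrix g p y - k y.1 • 1) A B)
        (extChartAt (𝓘(ℝ, ℝ).prod I) p).target :=
      (contDiffOn_shapeMatrix g p A B).continuousOn.sub (hk'.smul continuousOn_const)
    simp only [Matrix.trace, Matrix.diag_apply, Matrix.mul_apply]
    exact continuousOn_finsetSum _ fun A _ => continuousOn_finsetSum _ fun B _ =>
      (h A B).mul (h B A)
  · obtain ⟨P, hP, h⟩ := shapeMatrix_change g p hx s
    have h1 : P⁻¹ * P = 1 := Matrix.nonsing_inv_mul _ ((Matrix.isUnit_iff_isUnit_det _).1 hP)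
    have h2 : P * P⁻¹ = 1 := Matrix.mul_nonsing_inv _ ((Matrix.isUnit_iff_isUnit_det _).1 hP)
    have h3 : P⁻¹ * shapeOperator g (s, x) * P - k s • 1
        = P⁻¹ * (shapeOperator g (s, x) - k s • 1) * P := by
      rw [Matrix.mul_sub, Matrix.sub_mul, Matrix.mul_smul, Matrix.smul_mul, Matrix.mul_one, h1]
    rw [h, h3, shapeDeviation]
    set T := shapeOperator g (s, x) - k s • 1
    rw [← trace_conj hP]
    congr 1
    calc P⁻¹ * (T * T) * P = P⁻¹ * T * 1 * T * P := by
          rw [Matrix.mul_one, Matrix.mul_assoc P⁻¹ T T]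
      _ = _ := by rw [← h2]; simp only [Matrix.mul_assoc]

theorem sliceMatrixDeriv_isSymm (g : CylinderMetric I N a b) (p : radialInterval a b × N) :
    (sliceMatrixDeriv g p).IsSymm :=
  Matrix.IsSymm.ext fun A B => sliceBlockDeriv_symm g p _ B A

/-- Brings `S - k` into the form `G⁻¹ B` with `B` symmetric, to which the trace lemmas apply. -/
theorem shapeOperator_sub_smul (g : CylinderMetric I N a b) (k : ℝ)
    (p : radialInterval a b × N) :
    shapeOperator g p - k • 1
      = (sliceMatrix g p)⁻¹ * ((1 / 2 : ℝ) • sliceMatrixDeriv g p - k • sliceMatrix g p) := by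
  have h := Matrix.nonsing_inv_mul _ (isUnit_iff_ne_zero.2 (posDef_sliceMatrix g p).det_pos.ne')
  rw [shapeOperator_eq, Matrix.mul_sub, Matrix.mul_smul, Matrix.mul_smul, h]

theorem isSymm_half_sliceMatrixDeriv_sub (g : CylinderMetric I N a b) (k : ℝ)
    (p : radialInterval a b × N) :
    ((1 / 2 : ℝ) • sliceMatrixDeriv g p - k • sliceMatrix g p).IsSymm :=
  ((sliceMatrixDeriv_isSymm g p).smul _).sub
    (Matrix.IsSymm.smul (Matrix.IsSymm.ext fun _ _ => g.symm _ _ _) _)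

theorem shapeDeviation_nonneg (g : CylinderMetric I N a b) (k : ℝ → ℝ)
    (p : radialInterval a b × N) : 0 ≤ shapeDeviation g k p := by
  rw [shapeDeviation, shapeOperator_sub_smul]
  exact trace_sq_inv_mul_nonneg (posDef_sliceMatrix g p) (isSymm_half_sliceMatrixDeriv_sub g _ p)

theorem sliceMatrixDeriv_eq_of_shapeDeviation {g : CylinderMetric I N a b} {k : ℝ → ℝ}
    {p : radialInterval a b × N} (h : shapeDeviation g k p = 0) :
    sliceMatrixDeriv g p = (2 * k p.1) • sliceMatrix g p := by
  rw [shapeDeviation, shapeOperator_sub_smul] at h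
  have := eq_zero_of_trace_sq_inv_mul (posDef_sliceMatrix g p)
    (isSymm_half_sliceMatrixDeriv_sub g _ p) h
  rw [sub_eq_zero] at this
  have h2 := congrArg (fun X => (2 : ℝ) • X) this
  simpa [smul_smul] using h2

theorem shapeOperator_eq_smul_one {g : CylinderMetric I N a b} {k : ℝ}
    {p : radialInterval a b × N} (h : sliceMatrixDeriv g p = (2 * k) • sliceMatrix g p) :
    shapeOperator g p = k • 1 := by
  rw [← sub_eq_zero, shapeOperator_sub_smul, h, smul_smul]
  simp

end Shape

/-! ### Warped products and the derivative of the radial mass. -/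

section WarpedProduct

variable {d : ℕ} {H : Type*} [TopologicalSpace H]
  {I : ModelWithCorners ℝ (EuclideanSpace ℝ (Fin d)) H}
  {N : Type*} [TopologicalSpace N] [ChartedSpace H N] [IsManifold I ∞ N]
  {a b : EReal} {h : ℝ → ℝ}

theorem hasDerivAt_warping (h_smooth : ContDiffOn ℝ ∞ h (radialInterval a b))
    {s : ℝ} (hs : s ∈ radialInterval a b) : HasDerivAt h (deriv h s) s :=
  ((h_smooth.differentiableOn (by simp)).differentiableAt
    ((radialInterval a b).isOpen.mem_nhds hs)).hasDerivAt

theorem continuousOn_logDeriv_warping (h_smooth : ContDiffOn ℝ ∞ h (radialInterval a b))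
    (h_pos : ∀ r ∈ radialInterval a b, 0 < h r) :
    ContinuousOn (logDeriv h) (radialInterval a b) :=
  (h_smooth.continuousOn_deriv_of_isOpen (radialInterval a b).isOpen (by simp)).div
    h_smooth.continuousOn fun r hr => (h_pos r hr).ne'

theorem shapeOperator_warped (h_smooth : ContDiffOn ℝ ∞ h (radialInterval a b))
    (h_pos : ∀ r ∈ radialInterval a b, 0 < h r) {G : SmoothMetric I N}
    {g : CylinderMetric I N a b} (hg : IsWarpedProduct g h G) (p : radialInterval a b × N) :
    shapeOperator g p = logDeriv h p.1 • 1 := by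
  obtain ⟨s, x⟩ := p
  refine shapeOperator_eq_smul_one ?_
  ext A B
  refine (hasDerivAt_sliceBlock_center g s s x A B).unique ?_
  set c : ℝ := G.inner x (show EuclideanSpace ℝ (Fin d) from stdBasis d A)
    (show EuclideanSpace ℝ (Fin d) from stdBasis d B) with hc
  have hM (t : radialInterval a b) : sliceMatrix g (t, x) A B = h t ^ 2 * c := hg.2 (t, x) _ _
  have h1 : HasDerivAt (fun t => h t ^ 2 * c) (((2 * logDeriv h s) • sliceMatrix g (s, x)) A B)
      s := by
    refine (((hasDerivAt_warping h_smooth s.2).pow 2).mul_const c).congr_deriv ?_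
    have := (h_pos s s.2).ne'
    rw [Matrix.smul_apply, hM, logDeriv_apply, smul_eq_mul]
    field_simp
    ring
  refine h1.congr_of_eventuallyEq ?_
  filter_upwards [(radialInterval a b).isOpen.mem_nhds s.2] with t ht
  rw [← hM ⟨t, ht⟩, ← sliceBlock_center g s ⟨t, ht⟩ x]

/-- The radial derivative of `h² (H₀ - H)` is `h² (R_{rr} - R⁰_{rr}) + h² tr((S - S₀)²)`. -/
theorem hasDerivAt_radialMass (h_smooth : ContDiffOn ℝ ∞ h (radialInterval a b))
    (h_pos : ∀ r ∈ radialInterval a b, 0 < h r) {G : SmoothMetric I N}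
    {g g₀ : CylinderMetric I N a b} (hg : IsRadialMetric g) (hg₀ : IsWarpedProduct g₀ h G)
    (r s : radialInterval a b) (x : N) :
    HasDerivAt (fun t => h t ^ 2 * ((shapeMatrix g₀ (r, x) (t, extChartAt I x x)).trace
        - (shapeMatrix g (r, x) (t, extChartAt I x x)).trace))
      (ricciDefect g g₀ h (s, x) + h s ^ 2 * shapeDeviation g (logDeriv h) (s, x)) s := by
  have h1 := hasDerivAt_trace_shapeMatrix hg r s x
  have h2 := hasDerivAt_trace_shapeMatrix hg₀.1 r s x
  refine (((hasDerivAt_warping h_smooth s.2).pow 2).mul (h2.sub h1)).congr_deriv ?_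
  have hS₀ : shapeMatrix g₀ (r, x) ((s : ℝ), extChartAt I x x) = logDeriv h s • 1 :=
    shapeOperator_warped h_smooth h_pos hg₀ (s, x)
  have hS : shapeMatrix g (r, x) ((s : ℝ), extChartAt I x x) = shapeOperator g (s, x) := rfl
  have hh := (h_pos s s.2).ne'
  -- With `h' = k h` and `H₀ = d k`, the term from differentiating `h²` is `2k h² (d k - H)`, which
  -- turns `tr S² - d k²` into `tr (S - k)²`.
  have hk : deriv h s = logDeriv h s * h s := by
    rw [logDeriv_apply, div_mul_cancel₀ _ hh]
  rw [ricciDefect, shapeDeviation, hk]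
  simp only [hS₀, hS, Pi.pow_apply, Matrix.sub_mul, Matrix.mul_sub, Matrix.trace_sub, Matrix.smul_mul, Matrix.mul_smul,
    Matrix.one_mul, Matrix.mul_one, Matrix.trace_smul, Matrix.trace_one, smul_eq_mul, Pi.sub_apply,
    Fintype.card_fin]
  ring

/-- Both Weingarten maps are `(h'/h)·1`, so the two Riccati equations have the same left side and
the same quadratic term. -/
theorem radialRicci_eq_of_warped
    (h_smooth : ContDiffOn ℝ ∞ h (radialInterval a b))
    (h_pos : ∀ r ∈ radialInterval a b, 0 < h r) {G G' : SmoothMetric I N}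
    {g g' : CylinderMetric I N a b} (hg : IsWarpedProduct g h G) (hg' : IsWarpedProduct g' h G')
    (p : radialInterval a b × N) : radialRicci g p = radialRicci g' p := by
  obtain ⟨s, x⟩ := p
  have h1 := hasDerivAt_trace_shapeMatrix hg.1 s s x
  have h2 := hasDerivAt_trace_shapeMatrix hg'.1 s s x
  have hS (t : radialInterval a b) : shapeMatrix g (s, x) ((t : ℝ), extChartAt I x x)
      = shapeMatrix g' (s, x) ((t : ℝ), extChartAt I x x) :=
    (shapeOperator_warped h_smooth h_pos hg (t, x)).trans
      (shapeOperator_warped h_smooth h_pos hg' (t, x)).symm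
  have h3 := h1.congr_of_eventuallyEq (f₁ := fun t =>
    (shapeMatrix g' (s, x) (t, extChartAt I x x)).trace) (by
      filter_upwards [(radialInterval a b).isOpen.mem_nhds s.2] with t ht
      rw [hS ⟨t, ht⟩])
  have h4 := h3.unique h2
  rw [hS s] at h4
  linarith

theorem ricciDefect_eq_zero_of_warped (h_smooth : ContDiffOn ℝ ∞ h (radialInterval a b))
    (h_pos : ∀ r ∈ radialInterval a b, 0 < h r) {G G' : SmoothMetric I N}
    {g g' : CylinderMetric I N a b} (hg : IsWarpedProduct g h G) (hg' : IsWarpedProduct g' h G')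
    (p : radialInterval a b × N) : ricciDefect g g' h p = 0 := by
  rw [ricciDefect, radialRicci_eq_of_warped h_smooth h_pos hg hg', sub_self, mul_zero]

theorem ordConnected_radialInterval (a b : EReal) :
    (radialInterval a b : Set ℝ).OrdConnected :=
  ⟨fun _ hx _ hy _ hz => ⟨hx.1.trans_le (EReal.coe_le_coe_iff.2 hz.1),
    (EReal.coe_le_coe_iff.2 hz.2).trans_lt hy.2⟩⟩

/-- Vanishing deviation means `∂_r G = 2 (h'/h) G`, so `G / h²` has zero derivative on the interval.
-/
theorem sliceMetric_eq_of_shapeDeviation (h_smooth : ContDiffOn ℝ ∞ h (radialInterval a b))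
    (h_pos : ∀ r ∈ radialInterval a b, 0 < h r) {g : CylinderMetric I N a b}
    (h0 : ∀ p, shapeDeviation g (logDeriv h) p = 0) (r s : radialInterval a b) (x : N)
    (v w : EuclideanSpace ℝ (Fin d)) :
    sliceMetric g (s, x) v w = h s ^ 2 * ((h r ^ 2)⁻¹ * sliceMetric g (r, x) v w) := by
  have hM (A B : Fin d) : sliceMatrix g (s, x) A B
      = h s ^ 2 * ((h r ^ 2)⁻¹ * sliceMatrix g (r, x) A B) := by
    have hd (t : ℝ) (ht : t ∈ radialInterval a b) :
        HasDerivAt (fun t => sliceBlock g (r, x) (t, extChartAt I x x) A B / h t ^ 2) 0 t := by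
      have hh := (h_pos t ht).ne'
      refine ((hasDerivAt_sliceBlock_center g r ⟨t, ht⟩ x A B).div
        ((hasDerivAt_warping h_smooth ht).pow 2) (pow_ne_zero 2 hh)).congr_deriv ?_
      rw [sliceMatrixDeriv_eq_of_shapeDeviation (h0 _), Matrix.smul_apply,
        sliceBlock_center g r ⟨t, ht⟩ x, logDeriv_apply, smul_eq_mul]
      field_simp
      simp only [Nat.cast_ofNat, Nat.add_one_sub_one, pow_one, Pi.pow_apply]
      ring
    have hconst := (ordConnected_radialInterval a b).convex.is_const_of_fderivWithin_eq_zero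
      (𝕜 := ℝ) (f := fun t => sliceBlock g (r, x) (t, extChartAt I x x) A B / h t ^ 2)
      (fun t ht => (hd t ht).differentiableAt.differentiableWithinAt) (fun t ht => by
        rw [fderivWithin_of_isOpen (radialInterval a b).isOpen ht]
        rw [(hd t ht).hasFDerivAt.fderiv]
        ext
        simp) s.2 r.2
    have hs := (h_pos s s.2).ne'
    have hr := (h_pos r r.2).ne'
    simp only [sliceBlock_center g r] at hconst
    field_simp at hconst ⊢
    linarith
  rw [sliceMetric_eq_sum, sliceMetric_eq_sum g (r, x)]
  simp only [hM, Finset.mul_sum]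
  exact Finset.sum_congr rfl fun A _ => Finset.sum_congr rfl fun B _ => by ring

end WarpedProduct

/-! ### The Riemannian volume is finite and charges every nonempty open set. -/

section RiemannianVolume

variable {d : ℕ} {H : Type*} [TopologicalSpace H]
  {I : ModelWithCorners ℝ (EuclideanSpace ℝ (Fin d)) H}
  {N : Type*} [TopologicalSpace N] [ChartedSpace H N] [IsManifold I ∞ N]
  [MeasurableSpace N] [BorelSpace N]

theorem continuousOn_volumeDensity (G : SmoothMetric I N) (x : N) :
    ContinuousOn (fun y => Real.sqrt (metricMatrix (stdBasis d) G x y).det)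
      (extChartAt I x).target :=
  (contDiffOn_det (contDiffOn_metricMatrix (stdBasis d) G x)).continuousOn.sqrt

theorem measurableSet_extChartAt_target {E : Type*} [NormedAddCommGroup E] [NormedSpace ℝ E]
    [MeasurableSpace E] [BorelSpace E] {H : Type*} [TopologicalSpace H]
    {I : ModelWithCorners ℝ E H} {M : Type*} [TopologicalSpace M] [ChartedSpace H M] (x : M) :
    MeasurableSet (extChartAt I x).target := by
  rw [extChartAt_target]
  exact ((chartAt H x).open_target.preimage I.continuous_symm).measurableSet.inter
    I.isClosed_range.measurableSet

theorem aemeasurable_volumeDensity (G : SmoothMetric I N) (x : N) :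
    AEMeasurable (fun y => ENNReal.ofReal (Real.sqrt (metricMatrix (stdBasis d) G x y).det))
      (volume.restrict (extChartAt I x).target) :=
  ((continuousOn_volumeDensity G x).aemeasurable (measurableSet_extChartAt_target x)).ennreal_ofReal

theorem aemeasurable_extChartAt_symm (G : SmoothMetric I N) (x : N) :
    AEMeasurable (extChartAt I x).symm ((volume.restrict (extChartAt I x).target).withDensity
      (fun y => ENNReal.ofReal (Real.sqrt (metricMatrix (stdBasis d) G x y).det))) :=
  ((continuousOn_extChartAt_symm x).aemeasurable
    (measurableSet_extChartAt_target x)).mono_ac (withDensity_absolutelyContinuous _ _)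

/-- Near the boundary this set is only relatively open in the range of the model, but that range
lies in the closure of its interior, so the set still contains a nonempty open subset of `ℝ^d`. -/
theorem volume_target_inter_preimage_pos (x : N) {W : Set N} (hW : IsOpen W)
    (hne : ((extChartAt I x).source ∩ W).Nonempty) :
    volume ((extChartAt I x).target ∩ (extChartAt I x).symm ⁻¹' W) ≠ 0 := by
  obtain ⟨z, hz, hzW⟩ := hne
  set O : Set (EuclideanSpace ℝ (Fin d)) :=
    I.symm ⁻¹' ((chartAt H x).target ∩ (chartAt H x).symm ⁻¹' W) with hO
  have hOo : IsOpen O :=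
    ((chartAt H x).isOpen_inter_preimage_symm hW).preimage I.continuous_symm
  have heq : (extChartAt I x).target ∩ (extChartAt I x).symm ⁻¹' W = O ∩ range I := by
    ext y
    simp only [extChartAt_target, extChartAt_coe_symm, hO, mem_inter_iff, mem_preimage,
      Function.comp_apply]
    tauto
  have hmem : extChartAt I x z ∈ O ∩ range I := by
    rw [← heq]
    exact ⟨(extChartAt I x).map_source hz, by
      rwa [mem_preimage, (extChartAt I x).left_inv hz]⟩
  have hcl : extChartAt I x z ∈ closure (interior (range I)) :=
    I.range_subset_closure_interior hmem.2
  have hne' : (O ∩ interior (range I)).Nonempty := mem_closure_iff.1 hcl O hOo hmem.1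
  have hpos := (hOo.inter isOpen_interior).measure_pos volume hne'
  rw [heq]
  exact (hpos.trans_le (measure_mono (inter_subset_inter_right _ interior_subset))).ne'

variable [CompactSpace N] [T2Space N]

/-- At a point of the open set some partition function is positive, and the volume density of its
chart is positive too. This is what later upgrades vanishing almost everywhere to vanishing
everywhere. -/
theorem isOpenPosMeasure_riemannianVolume (G : SmoothMetric I N) :
    (riemannianVolume G).IsOpenPosMeasure := by
  refine ⟨fun U hU ⟨x, hx⟩ h0 => ?_⟩
  obtain ⟨i, hi⟩ := (chartPartition I N).exists_pos_of_mem (mem_univ x)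
  have hcont : Continuous (chartPartition I N i) := (chartPartition I N i).contMDiff.continuous
  have h1 := (Measure.sum_apply_eq_zero' hU.measurableSet).1 h0 i
  rw [withDensity_apply_eq_zero' hcont.measurable.ennreal_ofReal.aemeasurable] at h1
  set W : Set N := {x | 0 < chartPartition I N i x} ∩ U with hW
  have hWo : IsOpen W := (isOpen_lt continuous_const hcont).inter hU
  have h2 : chartVolume G i W = 0 := by
    have hsub : W ⊆ {x | ENNReal.ofReal (chartPartition I N i x) ≠ 0} ∩ U :=
      fun z hz => ⟨(ENNReal.ofReal_pos.2 hz.1).ne', hz.2⟩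
    exact measure_mono_null hsub h1
  rw [chartVolume, Measure.map_apply_of_aemeasurable (aemeasurable_extChartAt_symm G i)
    hWo.measurableSet, withDensity_apply_eq_zero' (aemeasurable_volumeDensity G i),
    Measure.restrict_apply₀' (measurableSet_extChartAt_target i).nullMeasurableSet] at h2
  have hne : ((extChartAt I i).source ∩ W).Nonempty := ⟨x, by
    rw [extChartAt_source]
    exact chartPartition_isSubordinate I N i (subset_tsupport _ hi.ne'), hi, hx⟩
  refine volume_target_inter_preimage_pos (I := I) i hWo hne
    (measure_mono_null (fun y hy => ?_) h2)
  refine ⟨⟨?_, hy.2⟩, hy.1⟩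
  have := (posDef_metricMatrix (stdBasis d) G i hy.1).det_pos
  simpa using this

/-- By compactness only finitely many partition functions are nonzero. The density may be unbounded
on a chart target, but it is continuous on the compact image of each support. -/
theorem isFiniteMeasure_riemannianVolume (G : SmoothMetric I N) :
    IsFiniteMeasure (riemannianVolume G) := by
  refine ⟨?_⟩
  rw [riemannianVolume, Measure.sum_apply _ MeasurableSet.univ]
  have hfin := (chartPartition I N).locallyFinite.finite_nonempty_of_compact
  rw [tsum_eq_sum (s := hfin.toFinset)]
  · refine ENNReal.sum_lt_top.2 fun i _ => ?_
    have hcont : Continuous (chartPartition I N i) := (chartPartition I N i).contMDiff.continuous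
    have hmeas : Measurable fun x => ENNReal.ofReal (chartPartition I N i x) :=
      hcont.measurable.ennreal_ofReal
    have hsub : tsupport (chartPartition I N i) ⊆ (extChartAt I i).source := by
      rw [extChartAt_source]
      exact chartPartition_isSubordinate I N i
    set K : Set (EuclideanSpace ℝ (Fin d)) := extChartAt I i '' tsupport (chartPartition I N i)
    have hK : IsCompact K := (isClosed_tsupport _).isCompact.image_of_continuousOn
      ((continuousOn_extChartAt i).mono hsub)
    have hKt : K ⊆ (extChartAt I i).target := by
      rintro _ ⟨z, hz, rfl⟩
      exact (extChartAt I i).map_source (hsub hz)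
    rw [withDensity_apply _ MeasurableSet.univ, Measure.restrict_univ, chartVolume,
      lintegral_map' hmeas.aemeasurable (aemeasurable_extChartAt_symm G i),
      lintegral_withDensity_eq_lintegral_mul₀' (aemeasurable_volumeDensity G i)
        (g := fun y => ENNReal.ofReal (chartPartition I N i ((extChartAt I i).symm y)))
        (hmeas.comp_aemeasurable (aemeasurable_extChartAt_symm G i))]
    have hle : ∀ y ∈ (extChartAt I i).target,
        ((fun y => ENNReal.ofReal (Real.sqrt (metricMatrix (stdBasis d) G i y).det)) *
          fun y => ENNReal.ofReal (chartPartition I N i ((extChartAt I i).symm y))) y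
        ≤ K.indicator
          (fun y => ENNReal.ofReal (Real.sqrt (metricMatrix (stdBasis d) G i y).det)) y := by
      intro y hy
      by_cases hyK : y ∈ K
      · rw [indicator_of_mem hyK]
        exact mul_le_of_le_one_right zero_le
          (ENNReal.ofReal_le_one.2 ((chartPartition I N).le_one _ _))
      · have : chartPartition I N i ((extChartAt I i).symm y) = 0 := by
          by_contra hne
          exact hyK ⟨_, subset_tsupport _ hne, (extChartAt I i).right_inv hy⟩
        rw [Pi.mul_apply, this, ENNReal.ofReal_zero, mul_zero]
        exact zero_le
    refine (setLIntegral_mono' (measurableSet_extChartAt_target i) hle).trans_lt ?_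
    refine (setLIntegral_le_lintegral _ _).trans_lt ?_
    rw [lintegral_indicator hK.measurableSet]
    exact (((continuousOn_volumeDensity G i).mono hKt).integrableOn_compact
      hK).setLIntegral_lt_top
  · intro i hi
    have h0 : ∀ x, chartPartition I N i x = 0 := by
      by_contra hne
      push Not at hne
      exact hi (hfin.mem_toFinset.2 hne)
    rw [withDensity_apply _ MeasurableSet.univ]
    simp [h0]

theorem isOpenPosMeasure_comap_subtype (U : TopologicalSpace.Opens ℝ) :
    (Measure.comap (Subtype.val : U → ℝ) volume).IsOpenPosMeasure := by
  refine ⟨fun V hV hne => ?_⟩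
  have h := (MeasurableEmbedding.subtype_coe U.isOpen.measurableSet).comap_apply volume V
  refine ne_of_eq_of_ne h ?_
  exact ((U.isOpen.isOpenEmbedding_subtypeVal.isOpenMap V hV).measure_pos volume
    (hne.image _)).ne'

end RiemannianVolume

/-! ### Comparing radial metrics, and metrics induced on a level set. -/

section SliceMetric

variable {d : ℕ} {H : Type*} [TopologicalSpace H]
  {I : ModelWithCorners ℝ (EuclideanSpace ℝ (Fin d)) H}
  {N : Type*} [TopologicalSpace N] [ChartedSpace H N] [IsManifold I ∞ N]
  {a b : EReal}

theorem radialNhds_neBot (hab : a < b) {r₀ : EReal} (h : r₀ ∈ Icc a b) :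
    (radialNhds a b r₀).NeBot := by
  rw [radialNhds, comap_neBot_iff_frequently]
  rw [← closure_Ioo hab.ne, mem_closure_iff_frequently] at h
  refine h.mono fun y hy => ?_
  -- Points strictly between `a` and `b` are finite, even if the end points are not.
  lift y to ℝ using ⟨(hy.2.trans_le le_top).ne, (bot_le.trans_lt hy.1).ne'⟩
  exact ⟨⟨y, hy⟩, rfl⟩

theorem tangent_eq_add (p : radialInterval a b × N) (v : ℝ × EuclideanSpace ℝ (Fin d)) :
    v = v.1 • (show ℝ × EuclideanSpace ℝ (Fin d) from radialField (I := I) p)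
      + (show ℝ × EuclideanSpace ℝ (Fin d) from liftTangent (I := I) p v.2) := by
  refine Prod.ext ?_ ?_ <;> simp [radialField, liftTangent]

theorem inner_eq_of_isRadialMetric {g : CylinderMetric I N a b} (hg : IsRadialMetric g)
    (p : radialInterval a b × N) (v w : ℝ × EuclideanSpace ℝ (Fin d)) :
    g.inner p v w = v.1 * w.1 + sliceMetric g p v.2 w.2 := by
  have key (L : (ℝ × EuclideanSpace ℝ (Fin d)) →L[ℝ] (ℝ × EuclideanSpace ℝ (Fin d)) →L[ℝ] ℝ)
      (u v' w' : ℝ × EuclideanSpace ℝ (Fin d)) (h1 : L u u = 1) (h2 : L u w' = 0)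
      (h3 : L v' u = 0) (s t : ℝ) : L (s • u + v') (t • u + w') = s * t + L v' w' := by
    simp [h1, h2, h3]
  have := key (g.inner p) (radialField (I := I) p) (liftTangent (I := I) p v.2)
    (liftTangent (I := I) p w.2) (hg.1 p) (hg.2 p _) ((g.symm p _ _).trans (hg.2 p _)) v.1 w.1
  refine Eq.trans ?_ this
  exact congrArg₂ (fun v w => (g.inner p : (ℝ × EuclideanSpace ℝ (Fin d)) →L[ℝ]
    (ℝ × EuclideanSpace ℝ (Fin d)) →L[ℝ] ℝ) v w) (tangent_eq_add (I := I) p v)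
    (tangent_eq_add (I := I) p w)

theorem cylinderMetric_ext {g g' : CylinderMetric I N a b} (hg : IsRadialMetric g)
    (hg' : IsRadialMetric g') (h : ∀ p, sliceMatrix g p = sliceMatrix g' p) : g = g' := by
  have hinner : g.inner = g'.inner := by
    funext p
    refine ContinuousLinearMap.ext fun v => ContinuousLinearMap.ext fun w => ?_
    refine (inner_eq_of_isRadialMetric hg p v w).trans
      (Eq.trans ?_ (inner_eq_of_isRadialMetric hg' p v w).symm)
    rw [sliceMetric_eq_sum, sliceMetric_eq_sum, h p]
  cases g
  cases g'
  cases hinner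
  rfl

theorem sliceMatrix_isSymm (g : CylinderMetric I N a b) (p : radialInterval a b × N) :
    (sliceMatrix g p).IsSymm :=
  Matrix.IsSymm.ext fun _ _ => g.symm _ _ _

/-- Puts the four-index contraction into the form `tr ((G₀⁻¹ T)²)`, so that vanishing distance
forces `T = 0`. -/
theorem sliceDistance_eq (g g₀ : CylinderMetric I N a b) (p : radialInterval a b × N) :
    sliceDistance g g₀ p = Real.sqrt
      ((sliceMatrix g₀ p)⁻¹ * (sliceMatrix g p - sliceMatrix g₀ p)
        * ((sliceMatrix g₀ p)⁻¹ * (sliceMatrix g p - sliceMatrix g₀ p))).trace := by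
  have hX : ((sliceMatrix g₀ p)⁻¹).IsSymm := (sliceMatrix_isSymm g₀ p).inv
  have hT : (sliceMatrix g p - sliceMatrix g₀ p).IsSymm :=
    (sliceMatrix_isSymm g p).sub (sliceMatrix_isSymm g₀ p)
  rw [sliceDistance]
  congr 1
  set X := (sliceMatrix g₀ p)⁻¹
  set T := sliceMatrix g p - sliceMatrix g₀ p
  simp only [Matrix.trace, Matrix.diag_apply, Matrix.mul_apply, Finset.sum_mul_sum]
  rw [Finset.sum_congr rfl fun A _ => Finset.sum_comm, Finset.sum_comm]
  refine Finset.sum_congr rfl fun C _ => ?_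
  rw [Finset.sum_comm]
  refine Finset.sum_congr rfl fun B _ => Finset.sum_congr rfl fun A _ =>
    Finset.sum_congr rfl fun D _ => ?_
  rw [hX.apply A C, hT.apply D C]
  ring

/-- From `s` to `r` both metrics are scaled by `h(r)² / h(s)²`; the factor cancels between `G₀⁻¹`
and `G - G₀`. -/
theorem sliceDistance_eq_of_warped {h : ℝ → ℝ} (h_pos : ∀ r ∈ radialInterval a b, 0 < h r)
    {G G₀ : SmoothMetric I N} {g g₀ : CylinderMetric I N a b} (hg : IsWarpedProduct g h G)
    (hg₀ : IsWarpedProduct g₀ h G₀) (r s : radialInterval a b) (x : N) :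
    sliceDistance g g₀ (r, x) = sliceDistance g g₀ (s, x) := by
  have hM {g : CylinderMetric I N a b} {G : SmoothMetric I N} (hg : IsWarpedProduct g h G) :
      sliceMatrix g (r, x) = (h r ^ 2 / h s ^ 2) • sliceMatrix g (s, x) := by
    ext A B
    have h1 : sliceMatrix g (r, x) A B = _ := hg.2 (r, x) _ _
    have h2 : sliceMatrix g (s, x) A B = _ := hg.2 (s, x) _ _
    rw [Matrix.smul_apply, h1, h2, smul_eq_mul]
    have := (h_pos s s.2).ne'
    field_simp
  have hc : h r ^ 2 / h s ^ 2 ≠ 0 := by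
    have := (h_pos s s.2).ne'
    have := (h_pos r r.2).ne'
    positivity
  rw [sliceDistance_eq, sliceDistance_eq, hM hg, hM hg₀, ← smul_sub]
  set c := h r ^ 2 / h s ^ 2
  have hinv : (c • sliceMatrix g₀ (s, x))⁻¹ = c⁻¹ • (sliceMatrix g₀ (s, x))⁻¹ := by
    refine Matrix.inv_eq_right_inv ?_
    rw [Matrix.smul_mul, Matrix.mul_smul, smul_smul, mul_inv_cancel₀ hc, one_smul,
      Matrix.mul_nonsing_inv _ (isUnit_iff_ne_zero.2 (posDef_sliceMatrix g₀ _).det_pos.ne')]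
  rw [hinv]
  simp only [Matrix.smul_mul, Matrix.mul_smul, smul_smul, mul_inv_cancel₀ hc,
    one_smul]

theorem eq_of_isAsymptoticAt (hab : a < b) {h : ℝ → ℝ}
    (h_pos : ∀ r ∈ radialInterval a b, 0 < h r)
    {G G₀ : SmoothMetric I N} {g g₀ : CylinderMetric I N a b} (hg : IsWarpedProduct g h G)
    (hg₀ : IsWarpedProduct g₀ h G₀) {r₀ : EReal} (hr₀ : r₀ ∈ Icc a b)
    (has : IsAsymptoticAt g g₀ r₀) : g = g₀ := by
  refine cylinderMetric_ext hg.1 hg₀.1 fun ⟨s, x⟩ => ?_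
  have := radialNhds_neBot hab hr₀
  have hle : sliceDistance g g₀ (s, x) ≤ 0 := by
    refine le_of_forall_pos_lt_add fun ε hε => ?_
    obtain ⟨r, hr⟩ := (has ε hε).exists
    rw [zero_add, ← sliceDistance_eq_of_warped h_pos hg hg₀ r s]
    exact hr x
  have hT : (sliceMatrix g (s, x) - sliceMatrix g₀ (s, x)).IsSymm :=
    (sliceMatrix_isSymm g _).sub (sliceMatrix_isSymm g₀ _)
  rw [sliceDistance_eq, Real.sqrt_le_left le_rfl] at hle
  have h0 := le_antisymm (hle.trans_eq (by simp))
    (trace_sq_inv_mul_nonneg (posDef_sliceMatrix g₀ (s, x)) hT)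
  exact sub_eq_zero.1 (eq_zero_of_trace_sq_inv_mul (posDef_sliceMatrix g₀ (s, x)) hT h0)

/-- Reduces smoothness of a family of bilinear forms to that of its matrix entries. -/
theorem clm_eq_sum_smul (L : EuclideanSpace ℝ (Fin d) →L[ℝ] EuclideanSpace ℝ (Fin d) →L[ℝ] ℝ) :
    L = ∑ A, ∑ B, L (stdBasis d A) (stdBasis d B) •
      (EuclideanSpace.proj (𝕜 := ℝ) A).smulRight (EuclideanSpace.proj (𝕜 := ℝ) B) := by
  ext v w
  conv_lhs => rw [← (stdBasis d).sum_repr v, ← (stdBasis d).sum_repr w]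
  simp only [map_sum, map_smul, sum_apply, smul_apply, smul_eq_mul, Finset.mul_sum,
    ContinuousLinearMap.smulRight_apply]
  rw [Finset.sum_comm]
  refine Finset.sum_congr rfl fun A _ => Finset.sum_congr rfl fun B _ => ?_
  simp
  ring

theorem inCoordinates_bilin_apply {x₀ x : N} (hx : x ∈ (chartAt H x₀).source)
    (φ : TangentSpace I x →L[ℝ] TangentSpace I x →L[ℝ] ℝ) (v w : EuclideanSpace ℝ (Fin d)) :
    ContinuousLinearMap.inCoordinates (EuclideanSpace ℝ (Fin d)) (TangentSpace I)
      (EuclideanSpace ℝ (Fin d) →L[ℝ] ℝ) (fun x : N => TangentSpace I x →L[ℝ] ℝ) x₀ x x₀ x φ v w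
      = φ (chartField x₀ v x) (chartField x₀ w x) := by
  have h := inCoordinates_apply_eq₂ (F₁ := EuclideanSpace ℝ (Fin d))
    (F₂ := EuclideanSpace ℝ (Fin d)) (F₃ := ℝ) (E₁ := (TangentSpace I : N → Type _))
    (E₂ := (TangentSpace I : N → Type _)) (E₃ := fun _ : N => ℝ) (x₀ := x₀) (x := x)
    (ϕ := φ) (v := v) (w := w) hx hx (Set.mem_univ _)
  have hc (v : EuclideanSpace ℝ (Fin d)) : chartField (I := I) x₀ v x
      = (trivializationAt (EuclideanSpace ℝ (Fin d)) (TangentSpace I) x₀).symm x v :=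
    (trivializationAt (EuclideanSpace ℝ (Fin d)) (TangentSpace I : N → Type _) x₀).symmL_apply
      (R := ℝ) hx v
  rw [hc, hc]
  refine h.trans ?_
  simp

/-- The metric `c G(r)` on `N`, for a constant `c > 0`. -/
def scaledSliceMetric (g : CylinderMetric I N a b) (r : radialInterval a b) (c : ℝ) (hc : 0 < c) :
    SmoothMetric I N where
  inner x := show EuclideanSpace ℝ (Fin d) →L[ℝ] EuclideanSpace ℝ (Fin d) →L[ℝ] ℝ from
    c • ContinuousLinearMap.bilinearComp (show (ℝ × EuclideanSpace ℝ (Fin d)) →L[ℝ]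
      (ℝ × EuclideanSpace ℝ (Fin d)) →L[ℝ] ℝ from g.inner (r, x))
      (ContinuousLinearMap.inr ℝ ℝ (EuclideanSpace ℝ (Fin d)))
      (ContinuousLinearMap.inr ℝ ℝ (EuclideanSpace ℝ (Fin d)))
  symm x v w := congrArg (c * ·) (g.symm (r, x) (liftTangent (r, x) v) (liftTangent (r, x) w))
  pos x v hv := by
    refine mul_pos hc (g.pos (r, x) (liftTangent (r, x) v) fun h0 => hv ?_)
    exact congrArg Prod.snd (show ((0 : ℝ), (show EuclideanSpace ℝ (Fin d) from v)) = 0 from h0)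
  isVonNBounded x := by
    have hb : Bornology.IsVonNBounded ℝ {v : ℝ × EuclideanSpace ℝ (Fin d) |
      (show (ℝ × EuclideanSpace ℝ (Fin d)) →L[ℝ] (ℝ × EuclideanSpace ℝ (Fin d)) →L[ℝ] ℝ
        from g.inner (r, x)) v v < 1} := g.isVonNBounded (r, x)
    have hb' : Bornology.IsVonNBounded ℝ {v : EuclideanSpace ℝ (Fin d) |
      c * (show (ℝ × EuclideanSpace ℝ (Fin d)) →L[ℝ] (ℝ × EuclideanSpace ℝ (Fin d)) →L[ℝ] ℝ
        from g.inner (r, x)) (0, v) (0, v) < 1} := by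
      rw [NormedSpace.isVonNBounded_iff, isBounded_iff_forall_norm_le] at hb ⊢
      obtain ⟨R, hR⟩ := hb
      refine ⟨R / Real.sqrt c, fun v hv => ?_⟩
      have hsc := Real.sqrt_pos.2 hc
      -- If `c g(v, v) < 1`, then `√c v` lies in the unit ball of `g`, which is bounded by `R`.
      have h1 := hR (Real.sqrt c • ((0 : ℝ), v)) (by
        rw [Set.mem_ofPred_eq, map_smul, map_smul, smul_apply, smul_smul, Real.mul_self_sqrt hc.le]
        exact hv)
      rw [norm_smul, Real.norm_of_nonneg hsc.le] at h1
      have h2 : ‖v‖ ≤ ‖((0 : ℝ), v)‖ := le_max_right _ _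
      rw [le_div_iff₀' hsc]
      exact (mul_le_mul_of_nonneg_left h2 hsc.le).trans h1
    exact hb'
  contMDiff := by
    intro x₀
    rw [contMDiffAt_hom_bundle]
    refine ⟨contMDiffAt_id, ?_⟩
    have hsm (A B : Fin d) : ContMDiffAt I 𝓘(ℝ, ℝ) ∞ (fun x => g.inner (r, x)
        (chartField (I := 𝓘(ℝ, ℝ).prod I) (r, x₀)
          ((0, stdBasis d A) : ℝ × EuclideanSpace ℝ (Fin d)) (r, x))
        (chartField (I := 𝓘(ℝ, ℝ).prod I) (r, x₀)
          ((0, stdBasis d B) : ℝ × EuclideanSpace ℝ (Fin d)) (r, x))) x₀ := by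
      have h1 := (contMDiffOn_inner_chartField g (r, x₀) (0, stdBasis d A)
        (0, stdBasis d B)).contMDiffAt ((chartAt (ModelProd ℝ H) (r, x₀)).open_source.mem_nhds
          (mem_chart_source _ (r, x₀)))
      exact ContMDiffAt.comp (I' := 𝓘(ℝ, ℝ).prod I) x₀ h1
        (contMDiffAt_const.prodMk contMDiffAt_id)
    have hsum : ContMDiffAt I
        𝓘(ℝ, EuclideanSpace ℝ (Fin d) →L[ℝ] EuclideanSpace ℝ (Fin d) →L[ℝ] ℝ) ∞
        (fun x => ∑ A, ∑ B, (c * g.inner (r, x)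
        (chartField (I := 𝓘(ℝ, ℝ).prod I) (r, x₀)
          ((0, stdBasis d A) : ℝ × EuclideanSpace ℝ (Fin d)) (r, x))
        (chartField (I := 𝓘(ℝ, ℝ).prod I) (r, x₀)
          ((0, stdBasis d B) : ℝ × EuclideanSpace ℝ (Fin d)) (r, x))) •
        (EuclideanSpace.proj (𝕜 := ℝ) A).smulRight (EuclideanSpace.proj (𝕜 := ℝ) B)) x₀ := by
      refine ContMDiffAt.sum fun A _ => ContMDiffAt.sum fun B _ => ?_
      exact (contMDiffAt_const.mul (hsm A B)).smul contMDiffAt_const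
    refine hsum.congr_of_eventuallyEq ?_
    filter_upwards [(chartAt H x₀).open_source.mem_nhds (mem_chart_source H x₀)] with x hx
    refine (clm_eq_sum_smul _).trans ?_
    refine Finset.sum_congr rfl fun A _ => Finset.sum_congr rfl fun B _ => ?_
    refine congrArg (· • _) ((inCoordinates_bilin_apply hx _ _ _).trans ?_)
    rw [chartField_zero_prod (r, x₀) (r, x) hx, chartField_zero_prod (r, x₀) (r, x) hx]
    rfl

end SliceMetric

/-! ### Integration over the cylinder and the limit at its ends. -/

section RadialIntegration

variable {a b : EReal}

theorem measurableEmbedding_opens_coe (U : TopologicalSpace.Opens ℝ) :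
    MeasurableEmbedding (Subtype.val : U → ℝ) :=
  MeasurableEmbedding.subtype_coe U.isOpen.measurableSet

theorem isLocallyFiniteMeasure_comap_subtype (U : TopologicalSpace.Opens ℝ) :
    IsLocallyFiniteMeasure (Measure.comap (Subtype.val : U → ℝ) volume) := by
  refine ⟨fun x => ⟨Subtype.val ⁻¹' Ioo ((x : ℝ) - 1) (x + 1), ?_, ?_⟩⟩
  · exact continuous_subtype_val.continuousAt (Ioo_mem_nhds (by linarith) (by linarith))
  · have h := (measurableEmbedding_opens_coe U).comap_apply volume
      (Subtype.val ⁻¹' Ioo ((x : ℝ) - 1) (x + 1))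
    refine h.trans_lt ((measure_mono (image_preimage_subset _ _)).trans_lt ?_)
    exact measure_Ioo_lt_top

theorem setIntegral_Ioc_radialInterval (f : ℝ → ℝ) (r s : radialInterval a b) :
    ∫ t in Ioc r s, f t ∂(Measure.comap (Subtype.val : radialInterval a b → ℝ) volume)
      = ∫ t in Ioc (r : ℝ) s, f t := by
  have he := measurableEmbedding_opens_coe (radialInterval a b)
  have h1 := he.setIntegral_map
    (μ := Measure.comap (Subtype.val : radialInterval a b → ℝ) volume) f (Ioc (r : ℝ) s)
  have h2 : (Subtype.val : radialInterval a b → ℝ) ⁻¹' Ioc (r : ℝ) s = Ioc r s := rfl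
  have h3 := he.map_comap volume
  rw [h2] at h1
  have h4 : Ioc (r : ℝ) s ∩ range (Subtype.val : radialInterval a b → ℝ) = Ioc (r : ℝ) s :=
    inter_eq_left.2 fun t ht => ⟨⟨t, (ordConnected_radialInterval a b).out r.2 s.2
      (Ioc_subset_Icc_self ht)⟩, rfl⟩
  rw [← h1, h3, Measure.restrict_restrict measurableSet_Ioc, h4]

theorem isCompact_Icc_radialInterval (r s : radialInterval a b) : IsCompact (Icc r s) := by
  rw [Subtype.isCompact_iff]
  convert isCompact_Icc (a := (r : ℝ)) (b := s)
  ext t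
  refine ⟨?_, fun ht => ⟨⟨t, (ordConnected_radialInterval a b).out r.2 s.2 ht⟩, ht, rfl⟩⟩
  rintro ⟨t, ht, rfl⟩
  exact ht

theorem eventually_radialNhds_lt {r₀ : EReal} {t : radialInterval a b}
    (h : r₀ < ((t : ℝ) : EReal)) : ∀ᶠ r in radialNhds a b r₀, r < t := by
  have : {z : EReal | z < ((t : ℝ) : EReal)} ∈ 𝓝 r₀ := Iio_mem_nhds h
  filter_upwards [preimage_mem_comap this] with r hr
  exact EReal.coe_lt_coe_iff.1 hr

theorem eventually_radialNhds_gt {r₀ : EReal} {t : radialInterval a b}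
    (h : ((t : ℝ) : EReal) < r₀) : ∀ᶠ r in radialNhds a b r₀, t < r := by
  have : {z : EReal | ((t : ℝ) : EReal) < z} ∈ 𝓝 r₀ := Ioi_mem_nhds h
  filter_upwards [preimage_mem_comap this] with r hr
  exact EReal.coe_lt_coe_iff.1 hr

/-- If `M' = ∫ D + ∫ q` along the cylinder with `q ≥ 0` continuous and `M(b) ≤ M(a)`, then
`∫ D ≤ 0`, and equality forces `q = 0`. -/
theorem integral_nonpos_of_increment {N : Type*} [TopologicalSpace N] [CompactSpace N] [T2Space N]
    [SecondCountableTopology N] [MeasurableSpace N] [BorelSpace N] {μ : Measure N}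
    [IsFiniteMeasure μ] [μ.IsOpenPosMeasure] (hab : a < b)
    {D q : radialInterval a b × N → ℝ} {M : radialInterval a b → ℝ} {massA massB : ℝ}
    (hD : Integrable D ((Measure.comap Subtype.val volume).prod μ))
    (hq : Continuous q) (hq0 : ∀ p, 0 ≤ q p)
    (hM : ∀ r s, r ≤ s → M s - M r
      = (∫ p in Ioc r s ×ˢ univ, D p ∂((Measure.comap Subtype.val volume).prod μ))
        + ∫ p in Ioc r s ×ˢ univ, q p ∂((Measure.comap Subtype.val volume).prod μ))
    (hA : Tendsto M (radialNhds a b a) (𝓝 massA)) (hB : Tendsto M (radialNhds a b b) (𝓝 massB))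
    (hmass : massB ≤ massA) :
    (∫ p, D p ∂((Measure.comap Subtype.val volume).prod μ)) ≤ 0 ∧
    ((∫ p, D p ∂((Measure.comap Subtype.val volume).prod μ)) = 0 → ∀ p, q p = 0) := by
  have := isLocallyFiniteMeasure_comap_subtype (radialInterval a b)
  have := isOpenPosMeasure_comap_subtype (radialInterval a b)
  set ν : Measure (radialInterval a b) := Measure.comap Subtype.val volume with hν
  have hqint (r s : radialInterval a b) : IntegrableOn q (Ioc r s ×ˢ univ) (ν.prod μ) :=
    (hq.continuousOn.integrableOn_compact
      ((isCompact_Icc_radialInterval r s).prod isCompact_univ)).mono_set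
      (prod_mono Ioc_subset_Icc_self subset_rfl)
  have hAne := radialNhds_neBot hab (left_mem_Icc.2 hab.le)
  have hBne := radialNhds_neBot hab (right_mem_Icc.2 hab.le)
  have hAc : (radialNhds a b a).IsCountablyGenerated := by rw [radialNhds]; infer_instance
  have hBc : (radialNhds a b b).IsCountablyGenerated := by rw [radialNhds]; infer_instance
  set l := radialNhds a b a ×ˢ radialNhds a b b with hl
  -- The slabs exhaust the cylinder as `r → a` and `s → b` independently.
  have hcover : AECover (ν.prod μ) l
      (fun rs : radialInterval a b × radialInterval a b => Ioc rs.1 rs.2 ×ˢ (univ : Set N)) := by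
    refine ⟨Eventually.of_forall fun p => ?_, fun rs => measurableSet_Ioc.prod .univ⟩
    filter_upwards [(eventually_radialNhds_lt (t := p.1) p.1.2.1).prod_mk
      (eventually_radialNhds_gt (t := p.1) p.1.2.2)] with rs h
    exact ⟨⟨h.1, h.2.le⟩, trivial⟩
  have hDlim := hcover.integral_tendsto_of_countably_generated hD
  have hMlim : Tendsto (fun rs : radialInterval a b × radialInterval a b => M rs.2 - M rs.1) l
      (𝓝 (massB - massA)) :=
    (hB.comp tendsto_snd).sub (hA.comp tendsto_fst)
  have hbelow (t : radialInterval a b) : ∀ᶠ rs in l, rs.1 < t ∧ t < rs.2 :=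
    (eventually_radialNhds_lt t.2.1).prod_mk (eventually_radialNhds_gt t.2.2)
  obtain ⟨t₀⟩ := hAne.nonempty
  -- Integrability of `q` over the whole cylinder is not assumed; its slab integrals converge
  -- because the other two terms do.
  have hqlim : Tendsto (fun rs : radialInterval a b × radialInterval a b =>
      ∫ p in Ioc rs.1 rs.2 ×ˢ univ, q p ∂(ν.prod μ)) l
      (𝓝 (massB - massA - ∫ p, D p ∂(ν.prod μ))) := by
    refine (hMlim.sub hDlim).congr' ?_
    filter_upwards [hbelow t₀] with rs h
    rw [hM rs.1 rs.2 (h.1.trans h.2).le]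
    ring
  have hL : 0 ≤ massB - massA - ∫ p, D p ∂(ν.prod μ) :=
    ge_of_tendsto' hqlim fun rs => integral_nonneg hq0
  refine ⟨by linarith, fun h0 p => ?_⟩
  rw [h0, sub_zero] at hqlim
  -- Slab integrals of `q ≥ 0` grow with the slab, so each is at most the limit `massB - massA ≤ 0`.
  have hzero (r s : radialInterval a b) : ∫ p in Ioc r s ×ˢ univ, q p ∂(ν.prod μ) = 0 := by
    refine le_antisymm (le_trans (ge_of_tendsto hqlim ?_) (sub_nonpos.2 hmass))
      (integral_nonneg hq0)
    filter_upwards [hbelow r, hbelow s] with rs hr hs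
    exact setIntegral_mono_set (hqint _ _) (Eventually.of_forall hq0)
      (prod_mono (Ioc_subset_Ioc hr.1.le hs.2.le) subset_rfl).eventuallyLE
  obtain ⟨⟨r, s⟩, hr, hs⟩ := (hbelow p.1).exists
  have hae : q =ᵐ[(ν.prod μ).restrict (Ioc r s ×ˢ univ)] 0 :=
    (setIntegral_eq_zero_iff_of_nonneg_ae (Eventually.of_forall hq0) (hqint r s)).1 (hzero r s)
  -- An open slab is needed to pass from almost everywhere to everywhere by continuity.
  have hae' : q =ᵐ[(ν.prod μ).restrict (Ioo r s ×ˢ univ)] 0 :=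
    ae_restrict_of_ae_restrict_of_subset (prod_mono Ioo_subset_Ioc_self subset_rfl) hae
  exact Measure.eqOn_open_of_ae_eq hae' (isOpen_Ioo.prod isOpen_univ) hq.continuousOn
    continuousOn_const ⟨⟨hr, hs⟩, trivial⟩

end RadialIntegration

/-! ### The increment of the total radial mass. -/

section MassIdentity

variable {d : ℕ} {H : Type*} [TopologicalSpace H]
  {I : ModelWithCorners ℝ (EuclideanSpace ℝ (Fin d)) H}
  {N : Type*} [TopologicalSpace N] [ChartedSpace H N] [IsManifold I ∞ N]
  {a b : EReal} {h : ℝ → ℝ}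

theorem setIntegral_Ioc_radialMass (h_smooth : ContDiffOn ℝ ∞ h (radialInterval a b))
    (h_pos : ∀ r ∈ radialInterval a b, 0 < h r) {G : SmoothMetric I N}
    {g g₀ : CylinderMetric I N a b} (hg : IsRadialMetric g) (hg₀ : IsWarpedProduct g₀ h G)
    {r s : radialInterval a b} (hrs' : r ≤ s) (x : N) :
    ∫ t in Ioc r s, (ricciDefect g g₀ h (t, x) + h t ^ 2 * shapeDeviation g (logDeriv h) (t, x))
        ∂(Measure.comap (Subtype.val : radialInterval a b → ℝ) volume)
      = radialMass g g₀ h (s, x) - radialMass g g₀ h (r, x) := by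
  have hrs : (r : ℝ) ≤ s := hrs'
  set F : ℝ → ℝ := fun t => h t ^ 2 * ((shapeMatrix g₀ (r, x) (t, extChartAt I x x)).trace
        - (shapeMatrix g (r, x) (t, extChartAt I x x)).trace) with hF
  have hd (t : radialInterval a b) := hasDerivAt_radialMass h_smooth h_pos hg hg₀ r t x
  have hFr (t : radialInterval a b) : F t = radialMass g g₀ h (t, x) := by
    rw [hF, radialMass, meanCurvature_eq hg₀.1 r t x, meanCurvature_eq hg r t x]
  have hFsmooth : ContDiffOn ℝ ∞ F (radialInterval a b) := by
    have hline : ContDiffOn ℝ ∞ (fun t : ℝ => (t, extChartAt I x x)) (radialInterval a b) :=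
      contDiffOn_id.prodMk contDiffOn_const
    have htr (g : CylinderMetric I N a b) : ContDiffOn ℝ ∞
        (fun t => (shapeMatrix g (r, x) (t, extChartAt I x x)).trace) (radialInterval a b) := by
      simp only [Matrix.trace, Matrix.diag_apply]
      exact ContDiffOn.sum fun A _ => (contDiffOn_shapeMatrix g (r, x) A A).comp hline
        fun t ht => mem_cylinder_target (r, x) ht (mem_extChartAt_target x)
    exact (h_smooth.pow 2).mul ((htr g₀).sub (htr g))
  have hsub : uIcc (r : ℝ) s ⊆ radialInterval a b := by
    rw [uIcc_of_le hrs]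
    exact (ordConnected_radialInterval a b).out r.2 s.2
  -- Integrating `deriv F` gives integrability directly from smoothness of `F`, without a separate
  -- continuity proof for the Ricci term.
  have h1 : ∫ t in (r : ℝ)..s, deriv F t = F s - F r :=
    intervalIntegral.integral_eq_sub_of_hasDerivAt
      (fun t ht => (hd ⟨t, hsub ht⟩).differentiableAt.hasDerivAt)
      ((hFsmooth.continuousOn_deriv_of_isOpen (radialInterval a b).isOpen
        (by simp)).mono hsub).intervalIntegrable
  rw [intervalIntegral.integral_of_le hrs, ← setIntegral_Ioc_radialInterval, hFr, hFr] at h1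
  rw [← h1]
  exact integral_congr_ae (Eventually.of_forall fun t => (hd t).deriv.symm)

theorem continuous_radialMass (h_smooth : ContDiffOn ℝ ∞ h (radialInterval a b))
    {g g₀ : CylinderMetric I N a b} (hg : IsRadialMetric g) (hg₀ : IsRadialMetric g₀) :
    Continuous (radialMass g g₀ h) := by
  have hh : Continuous fun p : radialInterval a b × N => h p.1 :=
    (continuousOn_iff_continuous_domRestrict.1 h_smooth.continuousOn).comp continuous_fst
  exact (hh.pow 2).mul ((continuous_meanCurvature hg₀).sub (continuous_meanCurvature hg))

variable [CompactSpace N] [T2Space N] [MeasurableSpace N] [BorelSpace N]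

theorem totalRadialMass_sub (h_smooth : ContDiffOn ℝ ∞ h (radialInterval a b))
    (h_pos : ∀ r ∈ radialInterval a b, 0 < h r) {G : SmoothMetric I N}
    {g g₀ : CylinderMetric I N a b} (hg : IsRadialMetric g) (hg₀ : IsWarpedProduct g₀ h G)
    (hint : Integrable (ricciDefect g g₀ h) (cylinderMeasure a b G))
    (hq : Continuous fun p : radialInterval a b × N =>
      h p.1 ^ 2 * shapeDeviation g (logDeriv h) p)
    {r s : radialInterval a b} (hrs : r ≤ s) :
    totalRadialMass g g₀ h G s - totalRadialMass g g₀ h G r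
      = (∫ p in Ioc r s ×ˢ univ, ricciDefect g g₀ h p ∂(cylinderMeasure a b G))
        + ∫ p in Ioc r s ×ˢ univ, h p.1 ^ 2 * shapeDeviation g (logDeriv h) p
          ∂(cylinderMeasure a b G) := by
  have := isFiniteMeasure_riemannianVolume G
  have := isLocallyFiniteMeasure_comap_subtype (radialInterval a b)
  have := I.secondCountableTopology
  have := ChartedSpace.secondCountable_of_sigmaCompact H N
  have hfin : IsFiniteMeasureOnCompacts (cylinderMeasure a b G) := by
    rw [cylinderMeasure]; infer_instance
  have hqint : IntegrableOn (fun p : radialInterval a b × N =>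
      h p.1 ^ 2 * shapeDeviation g (logDeriv h) p) (Ioc r s ×ˢ univ) (cylinderMeasure a b G) :=
    (hq.continuousOn.integrableOn_compact
      ((isCompact_Icc_radialInterval r s).prod isCompact_univ)).mono_set
      (prod_mono Ioc_subset_Icc_self subset_rfl)
  have hm (t : radialInterval a b) :
      Integrable (fun x => radialMass g g₀ h (t, x)) (riemannianVolume G) := by
    rw [← integrableOn_univ]
    exact ((continuous_radialMass h_smooth hg hg₀.1).comp
      (Continuous.prodMk_right t)).continuousOn.integrableOn_compact isCompact_univ
  rw [← integral_add hint.integrableOn hqint, totalRadialMass, totalRadialMass,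
    ← integral_sub (hm s) (hm r)]
  have hsum := hint.integrableOn (s := Ioc r s ×ˢ univ) |>.add hqint
  rw [IntegrableOn] at hsum
  rw [cylinderMeasure, ← Measure.prod_restrict, Measure.restrict_univ] at hsum ⊢
  -- Fubini with the radial integral innermost, so that the identity along each line applies.
  refine Eq.trans ?_ (integral_prod_symm _ hsum).symm
  exact integral_congr_ae (Eventually.of_forall fun x =>
    (setIntegral_Ioc_radialMass h_smooth h_pos hg hg₀ hrs x).symm)

end MassIdentity

/-! ### The inequality and its equality cases. -/

theorem mainTheorem5 {d : ℕ} (hd : 1 ≤ d)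
    {H : Type*} [TopologicalSpace H]
    (I : ModelWithCorners ℝ (EuclideanSpace ℝ (Fin d)) H)
    {N : Type*} [TopologicalSpace N] [ChartedSpace H N] [IsManifold I ∞ N]
    [CompactSpace N] [T2Space N] [MeasurableSpace N] [BorelSpace N]
    {a b : EReal} (hab : a < b)
    (h : ℝ → ℝ) (h_smooth : ContDiffOn ℝ ∞ h (radialInterval a b))
    (h_pos : ∀ r ∈ radialInterval a b, 0 < h r)
    (Ghat : SmoothMetric I N)
    (g g₀ : CylinderMetric I N a b)
    (hg : IsRadialMetric g) (hg₀ : IsWarpedProduct g₀ h Ghat)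
    {massA massB : ℝ}
    (hA : Tendsto (totalRadialMass g g₀ h Ghat) (radialNhds a b a) (𝓝 massA))
    (hB : Tendsto (totalRadialMass g g₀ h Ghat) (radialNhds a b b) (𝓝 massB))
    (hint : Integrable (ricciDefect g g₀ h) (cylinderMeasure a b Ghat))
    (hmass : massB ≤ massA) :
    (∫ p, ricciDefect g g₀ h p ∂(cylinderMeasure a b Ghat)) ≤ 0 ∧
    ((∫ p, ricciDefect g g₀ h p ∂(cylinderMeasure a b Ghat)) = 0 ↔
      ∃ Gtilde : SmoothMetric I N, IsWarpedProduct g h Gtilde) ∧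
    ∀ r₀ ∈ Icc a b, IsAsymptoticAt g g₀ r₀ →
      ((∫ p, ricciDefect g g₀ h p ∂(cylinderMeasure a b Ghat)) = 0 ↔ g = g₀) := by
  have := isFiniteMeasure_riemannianVolume Ghat
  have := isOpenPosMeasure_riemannianVolume Ghat
  have := I.secondCountableTopology
  have := ChartedSpace.secondCountable_of_sigmaCompact H N
  have hh : Continuous fun p : radialInterval a b × N => h p.1 :=
    (continuousOn_iff_continuous_domRestrict.1 h_smooth.continuousOn).comp continuous_fst
  have hq : Continuous fun p : radialInterval a b × N =>
      h p.1 ^ 2 * shapeDeviation g (logDeriv h) p :=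
    (hh.pow 2).mul (continuous_shapeDeviation g (continuousOn_logDeriv_warping h_smooth h_pos))
  obtain ⟨hle, heq⟩ := integral_nonpos_of_increment hab hint hq
    (fun p => mul_nonneg (sq_nonneg _) (shapeDeviation_nonneg g _ p))
    (fun r s hrs => totalRadialMass_sub h_smooth h_pos hg hg₀ hint hq hrs) hA hB hmass
  have hzero {G' : SmoothMetric I N} (hw : IsWarpedProduct g h G') :
      ∫ p, ricciDefect g g₀ h p ∂(cylinderMeasure a b Ghat) = 0 := by
    simp only [ricciDefect_eq_zero_of_warped h_smooth h_pos hw hg₀, integral_zero]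
  have hwarped (h0 : ∫ p, ricciDefect g g₀ h p ∂(cylinderMeasure a b Ghat) = 0) :
      ∃ Gtilde : SmoothMetric I N, IsWarpedProduct g h Gtilde := by
    obtain ⟨r⟩ := (radialNhds_neBot hab (left_mem_Icc.2 hab.le)).nonempty
    have hdev (p : radialInterval a b × N) : shapeDeviation g (logDeriv h) p = 0 :=
      (mul_eq_zero.1 (heq h0 p)).resolve_left (pow_ne_zero 2 (h_pos _ p.1.2).ne')
    -- The fixed metric is `G(r) / h(r)²` at an arbitrary `r`, since this quotient is constant in
    -- `r`.
    refine ⟨scaledSliceMetric g r (h r ^ 2)⁻¹ (inv_pos.2 (pow_pos (h_pos r r.2) 2)), hg,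
      fun p v w => ?_⟩
    exact sliceMetric_eq_of_shapeDeviation h_smooth h_pos hdev r p.1 p.2 v w
  refine ⟨hle, ⟨hwarped, fun ⟨_, hw⟩ => hzero hw⟩, fun r₀ hr₀ has => ⟨fun h0 => ?_, fun h0 => ?_⟩⟩
  · obtain ⟨G', hw⟩ := hwarped h0
    exact eq_of_isAsymptoticAt hab h_pos hw hg₀ hr₀ has
  · subst h0
    exact hzero hg₀
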